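/- Let $\Theta\subseteq\mathbb R^p$, let $\rho(\theta)$, $\theta\in\Theta$, be $d\times d$ density matrices (non-negative, trace one), let $\theta$ be an interior point of $\Theta$ at which $\rho$ is differentiable. For $\vec X=(X_1,\dots,X_p)$ with $X_i$ self-adjoint $d\times d$ matrices, let $Z(\vec X)$ be the $p\times p$ matrix with entries $\mathrm{trace}(\rho(\theta)X_iX_j)$, and consider the constraints $$\frac{\partial}{\partial\theta_i}\mathrm{trace}(\rho(\theta)X_j)=\delta_{ij}\quad(i,j\le p).\qquad(*)$$ Assume that some $\vec X$ satisfies $(*)$. For a positive-definite symmetric real $p\times p$ matrix $G$ define the Holevo bound $$\mathcal C_G=\inf\{\mathrm{trace}(GV):\ V \text{ real symmetric},\ V\ge Z(\vec X)\text{ for some }\vec X\text{ satisfying }(*)\}.$$ Let $\mathcal V$ be the set of positive-definite symmetric real $V$ with $\mathrm{trace}(GV)\ge\mathcal C_G$ for all positive-definite $G$, and let $\mathcal I$ be the set of positive-definite symmetric real $I$ with $\mathrm{trace}(GI^{-1})\ge\mathcal C_G$ for all positive-definite $G$. For positive-definite symmetric real $K$ let $\mathcal C^K$ be the level at which the hyperplane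 $\mathrm{trace}(KI)=\mathcal C^K$ supports $\mathcal I$ from above, i.e. $\mathcal C^K=\sup_{I\in\mathcal I}\mathrm{trace}(KI)$. For a measurement (POVM) $M$ on $N\ge1$ copies, i.e. on the state $\rho(\theta)^{\otimes N}$, let $\overline I_M$ be the Fisher information matrix at $\theta$ of the distribution of its outcome, divided by $N$. Theorem. Dual to the Holevo bounds $$\mathrm{trace}\,G\,\overline I_M^{-1}\ge\mathcal C_G\quad\text{for all positive-definite }G,\text{ all }N\ge 1\text{ and all measurements }M\text{ on }N\text{ copies with }\overline I_M\text{ nonsingular},$$ we have the upper bounds $$\mathrm{trace}\,K\,\overline I_M\le\mathcal C^K\quad\text{for all positive-definite }K,\text{ all }N\ge 1\text{ and all measurements }M\text{ on }N\text{ copies}.$$ If $I_0\in\mathcal I$ and a positive-definite $G_0$ satisfy $\mathrm{trace}\,G_0I_0^{-1}=\mathcal C_{G_0}$, then $\mathcal C^{K_0}=\mathcal C_{G_0}$ for $K_0=I_0^{-1}G_0I_0^{-1}$. Conversely, if $I_0\in\mathcal I$ and a positive-definite $K_0$ satisfy $\mathrm{trace}\,K_0I_0=\mathcal C^{K_0}$,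 then $\mathcal C_{G_0}=\mathcal C^{K_0}$ for $G_0=I_0K_0I_0$. None of the bounds is redundant: for all positive-definite $G$ and $K$, $\mathcal C_G=\inf_{V\in\mathcal V}\mathrm{trace}(GV)$ and $\mathcal C^K=\sup_{I\in\mathcal I}\mathrm{trace}(KI)$ (with $\mathcal I$ non-empty and the supremum finite). For every positive-definite $G$ there is exactly one $V\in\mathcal V$ with $\mathrm{trace}(GV)=\mathcal C_G$. -/

import Mathlib

open MeasureTheory Matrix
open scoped ComplexOrder Topology

namespace QuantumStat

noncomputable section

/-- A density matrix: non-negative (hence Hermitian) with trace one. -/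
def IsDensityMatrix {n : Type*} [Fintype n] (ρ : Matrix n n ℂ) : Prop :=
  ρ.PosSemidef ∧ ρ.trace = 1

/-- The partial derivative `∂f/∂θ_i` at the point `θ`. -/
def partialDeriv {p : ℕ} {E : Type*} [NormedAddCommGroup E] [NormedSpace ℝ E]
    (f : EuclideanSpace ℝ (Fin p) → E) (θ : EuclideanSpace ℝ (Fin p)) (i : Fin p) : E :=
  fderiv ℝ f θ (EuclideanSpace.single i 1)

/-! ### The Holevo bound -/

/-- The constraints on `X = (X_1, …, X_p)`: the `X_j` are Hermitian and
`∂/∂θ_i trace (ρ(θ) X_j) = δ_ij` at the given point `θ`. -/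
def IsLocallyUnbiased {p d : ℕ} (ρ : EuclideanSpace ℝ (Fin p) → Matrix (Fin d) (Fin d) ℂ)
    (θ : EuclideanSpace ℝ (Fin p)) (X : Fin p → Matrix (Fin d) (Fin d) ℂ) : Prop :=
  (∀ j, (X j).IsHermitian) ∧
    ∀ i j, partialDeriv (fun t => (ρ t * X j).trace) θ i = if i = j then 1 else 0

/-- The `p × p` Hermitian matrix `Z(X)` with entries `trace (ρ X_i X_j)`. -/
def zMatrix {p d : ℕ} (ρ : Matrix (Fin d) (Fin d) ℂ) (X : Fin p → Matrix (Fin d) (Fin d) ℂ) :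
    Matrix (Fin p) (Fin p) ℂ :=
  Matrix.of fun i j => (ρ * X i * X j).trace

/-- The Holevo bound `C_G` at `θ`: the infimum of `trace (G V)` over all `X` satisfying the
constraints and all real symmetric `V` with `V ≥ Z(X)` (as complex Hermitian matrices). -/
def holevoBound {p d : ℕ} (ρ : EuclideanSpace ℝ (Fin p) → Matrix (Fin d) (Fin d) ℂ)
    (θ : EuclideanSpace ℝ (Fin p)) (G : Matrix (Fin p) (Fin p) ℝ) : ℝ :=
  sInf {c | ∃ (X : Fin p → Matrix (Fin d) (Fin d) ℂ) (V : Matrix (Fin p) (Fin p) ℝ),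
    IsLocallyUnbiased ρ θ X ∧ V.IsSymm ∧
      (V.map (fun r : ℝ => (r : ℂ)) - zMatrix (ρ θ) X).PosSemidef ∧ c = (G * V).trace}

/-- The set `𝒱` of positive-definite symmetric real `V` with `trace (G V) ≥ C_G` for all
positive-definite symmetric real `G`. -/
def varianceSet {p d : ℕ} (ρ : EuclideanSpace ℝ (Fin p) → Matrix (Fin d) (Fin d) ℂ)
    (θ : EuclideanSpace ℝ (Fin p)) : Set (Matrix (Fin p) (Fin p) ℝ) :=
  {V | V.PosDef ∧ ∀ G : Matrix (Fin p) (Fin p) ℝ, G.PosDef → holevoBound ρ θ G ≤ (G * V).trace}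

/-- The set `ℐ` of positive-definite symmetric real `I` with `trace (G I⁻¹) ≥ C_G` for all
positive-definite symmetric real `G`. -/
def informationSet {p d : ℕ} (ρ : EuclideanSpace ℝ (Fin p) → Matrix (Fin d) (Fin d) ℂ)
    (θ : EuclideanSpace ℝ (Fin p)) : Set (Matrix (Fin p) (Fin p) ℝ) :=
  {I | I.PosDef ∧ ∀ G : Matrix (Fin p) (Fin p) ℝ, G.PosDef →
    holevoBound ρ θ G ≤ (G * I⁻¹).trace}

/-- The dual bound `C^K` at `θ`: the level at which the hyperplane `trace (K I) = C^K` supports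
the set `ℐ` from above. -/
def dualHolevoBound {p d : ℕ} (ρ : EuclideanSpace ℝ (Fin p) → Matrix (Fin d) (Fin d) ℂ)
    (θ : EuclideanSpace ℝ (Fin p)) (K : Matrix (Fin p) (Fin p) ℝ) : ℝ :=
  sSup ((fun I : Matrix (Fin p) (Fin p) ℝ => (K * I).trace) '' informationSet ρ θ)

/-! ### Measurements and Fisher information -/

/-- The state `ρ ⊗ ⋯ ⊗ ρ` of `N` copies; the standard basis of the `N`-fold tensor product of
`ℂ^d` is indexed by the functions `Fin N → Fin d`. -/
def tensorPower {d : ℕ} (N : ℕ) (ρ : Matrix (Fin d) (Fin d) ℂ) :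
    Matrix (Fin N → Fin d) (Fin N → Fin d) ℂ :=
  Matrix.of fun a b => ∏ k, ρ (a k) (b k)

/-- A measurement (positive operator valued measure) with outcome space `𝒳`, acting on the complex
Hilbert space with standard basis indexed by `n`. -/
structure POVM (𝒳 : Type*) [MeasurableSpace 𝒳] (n : Type*) [Fintype n] [DecidableEq n] where
  /-- The sigma-additive matrix-valued set function. -/
  toVectorMeasure : VectorMeasure 𝒳 (Matrix n n ℂ)
  posSemidef : ∀ B, MeasurableSet B → (toVectorMeasure B).PosSemidef
  univ_eq_one : toVectorMeasure Set.univ = 1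

namespace POVM

variable {𝒳 : Type*} [MeasurableSpace 𝒳] {n : Type*} [Fintype n] [DecidableEq n]

/-- The real set function `B ↦ trace (M(B))`. -/
def traceSigned (M : POVM 𝒳 n) : SignedMeasure 𝒳 :=
  M.toVectorMeasure.mapRange
    (Complex.reLm.toAddMonoidHom.comp (Matrix.traceAddMonoidHom n ℂ))
    (Complex.continuous_re.comp continuous_id.matrix_trace)

theorem traceSigned_apply (M : POVM 𝒳 n) (B : Set 𝒳) :
    M.traceSigned B = (M.toVectorMeasure B).trace.re := rfl

theorem traceSigned_nonneg (M : POVM 𝒳 n) : 0 ≤[Set.univ] M.traceSigned := by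
  rw [VectorMeasure.le_restrict_univ_iff_le, VectorMeasure.le_iff]
  intro B hB
  rw [traceSigned_apply]
  exact (Complex.le_def.1 (M.posSemidef B hB).trace_nonneg).1

/-- The finite real measure `B ↦ trace (M(B))`. -/
def traceMeasure (M : POVM 𝒳 n) : Measure 𝒳 :=
  M.traceSigned.toMeasureOfZeroLE Set.univ MeasurableSet.univ M.traceSigned_nonneg

/-- The complex measure `B ↦ M(B)_{ab}`. -/
def entry (M : POVM 𝒳 n) (a b : n) : ComplexMeasure 𝒳 :=
  M.toVectorMeasure.mapRange (Matrix.entryAddMonoidHom ℂ a b) (continuous_id.matrix_elem a b)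

/-- The matrix density `m(x)` of `M` with respect to the measure `trace (M(·))`. -/
def matrixDensity (M : POVM 𝒳 n) (x : 𝒳) : Matrix n n ℂ :=
  Matrix.of fun a b => (M.entry a b).rnDeriv M.traceMeasure x

/-- The density `x ↦ trace (σ m(x))` with respect to `trace (M(·))` of the law
`Pr(outcome ∈ B) = trace (σ M(B))` of the outcome when the state is `σ`. -/
def outcomeDensity (M : POVM 𝒳 n) (σ : Matrix n n ℂ) (x : 𝒳) : ℝ :=
  (σ * M.matrixDensity x).trace.re

end POVM

/-- The Fisher information matrix at `θ` of a parametric family of probability densities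
`f t : 𝒳 → ℝ` with respect to `μ`: the entries are `∫ (∂_i f) (∂_j f) / f dμ`, where the integrand
is `0` at the points at which `f θ` vanishes. -/
def fisherInformation {p : ℕ} {𝒳 : Type*} [MeasurableSpace 𝒳] (μ : Measure 𝒳)
    (f : EuclideanSpace ℝ (Fin p) → 𝒳 → ℝ) (θ : EuclideanSpace ℝ (Fin p)) :
    Matrix (Fin p) (Fin p) ℝ :=
  Matrix.of fun i j =>
    ∫ x, partialDeriv (fun t => f t x) θ i * partialDeriv (fun t => f t x) θ j / f θ x ∂μ

/-- The average Fisher information (Fisher information divided by `N`) at `θ` in the outcome of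
the measurement `M` on `N` copies of the system in state `ρ(θ)`. -/
def averageInformation {p d N : ℕ} {𝒳 : Type*} [MeasurableSpace 𝒳]
    (ρ : EuclideanSpace ℝ (Fin p) → Matrix (Fin d) (Fin d) ℂ)
    (M : POVM 𝒳 (Fin N → Fin d)) (θ : EuclideanSpace ℝ (Fin p)) :
    Matrix (Fin p) (Fin p) ℝ :=
  (N : ℝ)⁻¹ • fisherInformation M.traceMeasure
    (fun t => M.outcomeDensity (tensorPower N (ρ t))) θ

end

end QuantumStat

namespace QuantumStat

/-! ### Trace inequalities for positive matrices -/

section PosSemidef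

variable {ι 𝕜 : Type*} [Fintype ι] [RCLike 𝕜]

/-! Let D be the set of real symmetric V with V ≥ Z(X) for some admissible X, so that C_G is the
infimum of trace(GV) over D. Everything rests on D and the set of inverses of its members both being
convex. For D this is convexity of X ↦ Z(X). For the inverses, put J = V⁻¹ and U = V⁻¹X: the
conditions become J ≥ Z(U) and trace(δ_i U_j) = J_ij, with δ_i the partial derivative of ρ. These
are convex conditions on the pair (J, U), and they make sense for singular J as well
(`attainableInformation`, `mem_invSet_attainableVariance_iff`).

The duality is then convex geometry, done for an abstract `IsVarianceRegion`. By Hahn–Banach, 𝒱 lies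
in the closure of D, hence ℐ lies in the closure of the inverses and is convex. If trace(G₀I⁻¹) is
minimal over ℐ at I₀, its derivative along a segment from I₀ into ℐ is nonnegative; that derivative
is −trace(K₀(I − I₀)) with K₀ = I₀⁻¹G₀I₀⁻¹, so the plane trace(K₀I) = C_{G₀} supports ℐ. The
converse, and uniqueness of the minimizer, come from completing a square (`trace_mul_square`).
Existence is compactness of the sublevel sets of trace(G·) on 𝒱.

Positivity of V and finiteness of C^K need D ≥ ε·1. This is a quantum Cramér–Rao inequality. At an
interior point, θ minimizes t ↦ ⟨v, ρ(t)v⟩ when v is in the kernel of ρ(θ), so δ_i has zero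
quadratic form on that kernel and a symmetric logarithmic derivative exists even for singular ρ(θ).

For measurements, the average information is shown to lie in the closure of `attainableInformation`
(`averageInformation_mem_closure`). Let t_j be the scores and Y_j = ∫ t_j dM. Tracing Y_j against ρ
on all sites but one, summing over the sites and centring gives one-copy matrices U_j. Then
trace(δ_i U_j) is the Fisher information, and Z(U) is at most N times it, because sums of centred
one-site operators are orthogonal across sites and projecting onto them does not increase the norm.
Division by N gives a member of `attainableInformation`. Unbounded scores are truncated, and the
limit is taken by dominated convergence. -/

theorem trace_mul_vecMulVec_star (A : Matrix ι ι 𝕜) (v : ι → 𝕜) :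
    (A * vecMulVec v (star v)).trace = star v ⬝ᵥ A *ᵥ v := by
  rw [mul_vecMulVec, trace_vecMulVec, dotProduct_comm]

theorem trace_mul_nonneg_of_posSemidef {A B : Matrix ι ι 𝕜} (hA : A.PosSemidef)
    (hB : B.PosSemidef) : 0 ≤ (A * B).trace := by
  obtain ⟨m, v, rfl⟩ := posSemidef_iff_eq_sum_vecMulVec.1 hB
  rw [Matrix.mul_sum, trace_sum]
  exact Finset.sum_nonneg fun k _ => by
    rw [trace_mul_vecMulVec_star]
    exact hA.dotProduct_mulVec_nonneg _

theorem eq_zero_of_trace_mul_eq_zero {A B : Matrix ι ι 𝕜} (hA : A.PosDef)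
    (hB : B.PosSemidef) (h : (A * B).trace = 0) : B = 0 := by
  obtain ⟨m, v, rfl⟩ := posSemidef_iff_eq_sum_vecMulVec.1 hB
  rw [Matrix.mul_sum, trace_sum, Finset.sum_eq_zero_iff_of_nonneg] at h
  · refine Finset.sum_eq_zero fun k hk => ?_
    have h0 := h k hk
    rw [trace_mul_vecMulVec_star] at h0
    have : v k = 0 := by
      by_contra hne
      exact (hA.dotProduct_mulVec_pos hne).ne' h0
    simp [this]
  · intro k _
    rw [trace_mul_vecMulVec_star]
    exact hA.posSemidef.dotProduct_mulVec_nonneg _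

/-- Positivity is used twice: first A forces BCB = 0, then cyclicity and C force BB = 0. This is the
equality case of the completed square. -/
theorem eq_zero_of_trace_mul_mul_mul_eq_zero {A C B : Matrix ι ι 𝕜} (hA : A.PosDef)
    (hC : C.PosDef) (hB : B.IsHermitian) (h : (A * (B * C * B)).trace = 0) : B = 0 := by
  have hpsd : (B * C * B).PosSemidef := by
    have := hC.posSemidef.conjTranspose_mul_mul_same B
    rwa [hB.eq] at this
  have h0 := eq_zero_of_trace_mul_eq_zero hA hpsd h
  have h1 : B * Bᴴ = 0 := by
    refine eq_zero_of_trace_mul_eq_zero hC (posSemidef_self_mul_conjTranspose B) ?_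
    rw [hB.eq, ← Matrix.mul_assoc, trace_mul_comm, ← Matrix.mul_assoc, h0, trace_zero]
  exact self_mul_conjTranspose_eq_zero.1 h1

/-- The test matrix vvᵀ is only semidefinite, so it is approximated by vvᵀ + η·1 with η ↓ 0. -/
theorem posSemidef_of_forall_trace_mul_nonneg [DecidableEq ι] {W : Matrix ι ι ℝ} (hW : W.IsSymm)
    (h : ∀ G : Matrix ι ι ℝ, G.PosDef → 0 ≤ (G * W).trace) : W.PosSemidef := by
  refine .of_dotProduct_mulVec_nonneg (isHermitian_iff_isSymm.2 hW) fun v => ?_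
  have key : ∀ η : ℝ, 0 < η → 0 ≤ star v ⬝ᵥ W *ᵥ v + η * W.trace := by
    intro η hη
    have := h (vecMulVec v (star v) + η • 1)
      (PosDef.posSemidef_add (posSemidef_vecMulVec_self_star v) (PosDef.one.smul hη))
    rwa [Matrix.add_mul, trace_add, trace_mul_comm, trace_mul_vecMulVec_star, smul_mul_assoc,
      Matrix.one_mul, trace_smul, smul_eq_mul] at this
  have ht : Filter.Tendsto (fun η : ℝ => star v ⬝ᵥ W *ᵥ v + η * W.trace) (𝓝[>] 0)
      (𝓝 (star v ⬝ᵥ W *ᵥ v + 0 * W.trace)) := by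
    refine Filter.Tendsto.mono_left ?_ nhdsWithin_le_nhds
    exact (by fun_prop : Continuous fun η : ℝ => star v ⬝ᵥ W *ᵥ v + η * W.trace).tendsto 0
  simpa using ge_of_tendsto ht (eventually_nhdsWithin_of_forall fun η hη => key η hη)

theorem abs_apply_le_trace [DecidableEq ι] {V : Matrix ι ι ℝ} (hV : V.PosSemidef) (i j : ι) :
    |V i j| ≤ V.trace := by
  have hd : ∀ k, V k k ≤ V.trace := fun k =>
    Finset.single_le_sum (f := fun k => V k k) (fun k _ => hV.diag_nonneg) (Finset.mem_univ k)
  have hs : V j i = V i j := hV.1.apply i j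
  have h1 := hV.dotProduct_mulVec_nonneg (Pi.single i 1 + Pi.single j 1)
  have h2 := hV.dotProduct_mulVec_nonneg (Pi.single i 1 - Pi.single j 1)
  simp [mulVec_add, mulVec_sub, hs] at h1 h2
  rw [abs_le]
  constructor <;> linarith [hd i, hd j]

/-- Completing the square for the inverse of a positive definite matrix. -/
theorem trace_mul_square [DecidableEq ι] {K A V : Matrix ι ι ℝ} (hV : V.PosDef) :
    (K * ((V⁻¹ - A) * V * (V⁻¹ - A))).trace
      = (K * V⁻¹).trace - 2 * (K * A).trace + (A * K * A * V).trace := by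
  have hu : IsUnit V.det := (isUnit_iff_isUnit_det V).1 hV.isUnit
  have : (V⁻¹ - A) * V * (V⁻¹ - A) = V⁻¹ - (2 : ℝ) • A + A * V * A := by
    rw [sub_mul, nonsing_inv_mul V hu, sub_mul, mul_sub, mul_sub, Matrix.mul_assoc A V V⁻¹,
      mul_nonsing_inv V hu, two_smul, Matrix.one_mul, Matrix.one_mul, Matrix.mul_one]
    abel
  rw [this, Matrix.mul_add, Matrix.mul_sub, trace_add, trace_sub, Matrix.mul_smul, trace_smul,
    ← Matrix.mul_assoc, trace_mul_comm (K * (A * V)) A]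
  simp [Matrix.mul_assoc]

/-- A spectrum-free form of G ≥ κ⁻¹·1. An entrywise estimate gives trace(VG⁻¹) ≤ R trace V. The
completed square with V, G⁻¹ and (R+1)⁻¹·1 in the roles of K, V and A turns it into a lower bound
for trace(GV). It bounds the sublevel sets of trace(G·). -/
theorem exists_trace_le_mul_trace_mul [DecidableEq ι] {G : Matrix ι ι ℝ} (hG : G.PosDef) :
    ∃ κ : ℝ, ∀ V : Matrix ι ι ℝ, V.PosSemidef → V.trace ≤ κ * (G * V).trace := by
  set R : ℝ := ∑ _i : ι, ∑ _j : ι, G⁻¹.trace with hR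
  have hR0 : 0 ≤ R := Finset.sum_nonneg fun i _ => Finset.sum_nonneg fun j _ =>
    hG.inv.posSemidef.trace_nonneg
  refine ⟨R + 1, fun V hV => ?_⟩
  have hVG : (V * G⁻¹).trace ≤ R * V.trace := by
    rw [trace, hR, Finset.sum_mul]
    refine Finset.sum_le_sum fun i _ => ?_
    rw [diag_apply, mul_apply, Finset.sum_mul]
    refine Finset.sum_le_sum fun j _ => ?_
    refine (le_abs_self _).trans ?_
    rw [abs_mul, mul_comm]
    exact mul_le_mul (abs_apply_le_trace hG.inv.posSemidef j i) (abs_apply_le_trace hV i j)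
      (abs_nonneg _) hG.inv.posSemidef.trace_nonneg
  have hsq := trace_mul_square (K := V) (A := (R + 1)⁻¹ • (1 : Matrix ι ι ℝ)) hG.inv
  have hGG : G⁻¹⁻¹ = G := nonsing_inv_nonsing_inv G ((isUnit_iff_isUnit_det G).1 hG.isUnit)
  have hpos : 0 ≤ (V * ((G⁻¹⁻¹ - (R + 1)⁻¹ • (1 : Matrix ι ι ℝ)) * G⁻¹ *
      (G⁻¹⁻¹ - (R + 1)⁻¹ • (1 : Matrix ι ι ℝ)))).trace := by
    have hh : (G⁻¹⁻¹ - (R + 1)⁻¹ • (1 : Matrix ι ι ℝ)).IsHermitian :=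
      hG.inv.inv.isHermitian.sub (isHermitian_one.smul (IsSelfAdjoint.all _))
    have := hG.inv.posSemidef.conjTranspose_mul_mul_same (G⁻¹⁻¹ - (R + 1)⁻¹ • (1 : Matrix ι ι ℝ))
    rw [hh.eq] at this
    exact trace_mul_nonneg_of_posSemidef hV this
  rw [hsq, hGG] at hpos
  simp only [Matrix.mul_smul, Matrix.smul_mul, Matrix.mul_one, Matrix.one_mul, trace_smul,
    smul_eq_mul] at hpos
  have hV0 : 0 ≤ V.trace := hV.trace_nonneg
  rw [trace_mul_comm V G] at hpos
  have h1 : (R + 1) * (R + 1)⁻¹ = 1 := mul_inv_cancel₀ (by linarith)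
  have h2 : (R + 1)⁻¹ * ((R + 1)⁻¹ * (V * G⁻¹).trace) ≤ (R + 1)⁻¹ * V.trace := by
    have h3 : (R + 1)⁻¹ * (V * G⁻¹).trace ≤ V.trace := by
      rw [inv_mul_le_iff₀ (by linarith)]
      nlinarith
    exact mul_le_mul_of_nonneg_left h3 (inv_nonneg.2 (by linarith))
  have h4 : (R + 1)⁻¹ * V.trace ≤ (G * V).trace := by linarith
  rwa [inv_mul_le_iff₀ (by linarith)] at h4

end PosSemidef

/-! ### Duality for an abstract convex region with convex inverse set -/

section VarianceRegion

variable {ι : Type*} [Fintype ι] [DecidableEq ι] {D : Set (Matrix ι ι ℝ)}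

/-- A convex set of real symmetric matrices, bounded below by a positive definite matrix and closed
under adding positive semidefinite matrices, for which the set of inverses is convex too. -/
structure IsVarianceRegion (D : Set (Matrix ι ι ℝ)) : Prop where
  nonempty : D.Nonempty
  exists_le : ∃ ε : ℝ, 0 < ε ∧ ∀ V ∈ D, (V - ε • 1).PosSemidef
  convex : Convex ℝ D
  add_mem : ∀ V ∈ D, ∀ W : Matrix ι ι ℝ, W.PosSemidef → V + W ∈ D
  convex_inv : Convex ℝ {J : Matrix ι ι ℝ | J.PosDef ∧ J⁻¹ ∈ D}

/-- The infimum of `trace (G V)` over `V ∈ D`. -/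
noncomputable def supportLevel (D : Set (Matrix ι ι ℝ)) (G : Matrix ι ι ℝ) : ℝ :=
  sInf ((fun V => (G * V).trace) '' D)

/-- The positive definite matrices on the right side of all hyperplanes supporting `D`. -/
def supportedSet (D : Set (Matrix ι ι ℝ)) : Set (Matrix ι ι ℝ) :=
  {V | V.PosDef ∧ ∀ G : Matrix ι ι ℝ, G.PosDef → supportLevel D G ≤ (G * V).trace}

/-- The matrices whose inverse lies in `supportedSet D`. -/
def supportedInvSet (D : Set (Matrix ι ι ℝ)) : Set (Matrix ι ι ℝ) :=
  {J | J.PosDef ∧ ∀ G : Matrix ι ι ℝ, G.PosDef → supportLevel D G ≤ (G * J⁻¹).trace}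

/-- The positive definite matrices whose inverse lies in `D`. -/
def invSet (D : Set (Matrix ι ι ℝ)) : Set (Matrix ι ι ℝ) := {J | J.PosDef ∧ J⁻¹ ∈ D}

omit [Fintype ι] in
theorem posDef_of_posSemidef_sub_smul_one {V : Matrix ι ι ℝ} {ε : ℝ} (hε : 0 < ε)
    (h : (V - ε • 1).PosSemidef) : V.PosDef := by
  have := PosDef.posSemidef_add h (PosDef.one.smul hε)
  rwa [sub_add_cancel] at this

theorem trace_mul_le_of_posSemidef_sub_smul_one {V G : Matrix ι ι ℝ} {ε : ℝ}
    (hG : G.PosSemidef) (h : (V - ε • 1).PosSemidef) : ε * G.trace ≤ (G * V).trace := by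
  have := trace_mul_nonneg_of_posSemidef hG h
  rw [Matrix.mul_sub, trace_sub, Matrix.mul_smul, trace_smul, Matrix.mul_one, smul_eq_mul] at this
  linarith

theorem continuousAt_inv_of_posDef {J : Matrix ι ι ℝ} (hJ : J.PosDef) :
    ContinuousAt (fun A : Matrix ι ι ℝ => A⁻¹) J := by
  refine continuousAt_matrix_inv J ?_
  have : (Ring.inverse : ℝ → ℝ) = Inv.inv := by
    funext x; exact Ring.inverse_eq_inv x
  rw [this]
  exact continuousAt_inv₀ hJ.det_pos.ne'

theorem isUnit_det_of_posDef {J : Matrix ι ι ℝ} (hJ : J.PosDef) : IsUnit J.det :=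
  (isUnit_iff_isUnit_det J).1 hJ.isUnit

theorem inv_inv_of_posDef {J : Matrix ι ι ℝ} (hJ : J.PosDef) : J⁻¹⁻¹ = J :=
  nonsing_inv_nonsing_inv J (isUnit_det_of_posDef hJ)

namespace IsVarianceRegion

theorem posDef (h : IsVarianceRegion D) {V : Matrix ι ι ℝ} (hV : V ∈ D) : V.PosDef :=
  let ⟨_, hε, hD⟩ := h.exists_le
  posDef_of_posSemidef_sub_smul_one hε (hD V hV)

theorem bddBelow (h : IsVarianceRegion D) {G : Matrix ι ι ℝ} (hG : G.PosSemidef) :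
    BddBelow ((fun V => (G * V).trace) '' D) := by
  refine ⟨0, ?_⟩
  rintro _ ⟨V, hV, rfl⟩
  exact trace_mul_nonneg_of_posSemidef hG (h.posDef hV).posSemidef

theorem supportLevel_le (h : IsVarianceRegion D) {G V : Matrix ι ι ℝ} (hG : G.PosSemidef)
    (hV : V ∈ D) : supportLevel D G ≤ (G * V).trace :=
  csInf_le (h.bddBelow hG) ⟨V, hV, rfl⟩

theorem le_supportLevel (h : IsVarianceRegion D) {G : Matrix ι ι ℝ} {c : ℝ}
    (hc : ∀ V ∈ D, c ≤ (G * V).trace) : c ≤ supportLevel D G := by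
  refine le_csInf (h.nonempty.image _) ?_
  rintro _ ⟨V, hV, rfl⟩
  exact hc V hV

theorem subset_supportedSet (h : IsVarianceRegion D) : D ⊆ supportedSet D := fun _ hV =>
  ⟨h.posDef hV, fun _ hG => h.supportLevel_le hG.posSemidef hV⟩

theorem mem_supportedInvSet_iff {J : Matrix ι ι ℝ} :
    J ∈ supportedInvSet D ↔ J.PosDef ∧ J⁻¹ ∈ supportedSet D :=
  ⟨fun hJ => ⟨hJ.1, hJ.1.inv, hJ.2⟩, fun hJ => ⟨hJ.1, hJ.2.2⟩⟩

theorem inv_mem_supportedInvSet {V : Matrix ι ι ℝ} (hV : V ∈ supportedSet D) :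
    V⁻¹ ∈ supportedInvSet D :=
  mem_supportedInvSet_iff.2 ⟨hV.1.inv, by rwa [inv_inv_of_posDef hV.1]⟩

/-- The lower bound on D passes to the intersection of its supporting half-spaces. Positive
definiteness is thus automatic there, which makes the supported set closed. -/
theorem exists_le_of_supported (h : IsVarianceRegion D) : ∃ ε : ℝ, 0 < ε ∧
    ∀ V : Matrix ι ι ℝ, V.IsSymm →
      (∀ G : Matrix ι ι ℝ, G.PosDef → supportLevel D G ≤ (G * V).trace) →
      (V - ε • 1).PosSemidef := by
  obtain ⟨ε, hε, hD⟩ := h.exists_le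
  refine ⟨ε, hε, fun V hV hG => ?_⟩
  refine posSemidef_of_forall_trace_mul_nonneg (hV.sub ?_) fun G hGp => ?_
  · exact isHermitian_iff_isSymm.1 (isHermitian_one.smul (IsSelfAdjoint.all _))
  · have := (h.le_supportLevel fun V hV =>
      trace_mul_le_of_posSemidef_sub_smul_one hGp.posSemidef (hD V hV)).trans (hG G hGp)
    rw [Matrix.mul_sub, trace_sub, Matrix.mul_smul, trace_smul, Matrix.mul_one, smul_eq_mul]
    linarith

/-- Hahn–Banach separates V from the closure of D. Since D absorbs semidefinite matrices, the
separating functional is semidefinite, and adding η·1 makes it one of the admissible definite G. -/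
theorem mem_closure_of_supported (h : IsVarianceRegion D) {V : Matrix ι ι ℝ} (hV : V.IsSymm)
    (hG : ∀ G : Matrix ι ι ℝ, G.PosDef → supportLevel D G ≤ (G * V).trace) : V ∈ closure D := by
  by_contra hVD
  have : LocallyConvexSpace ℝ (Matrix ι ι ℝ) :=
    inferInstanceAs (LocallyConvexSpace ℝ (ι → ι → ℝ))
  obtain ⟨f, u, hfV, hfD⟩ := geometric_hahn_banach_point_closed h.convex.closure isClosed_closure hVD
  -- The functional lives on all matrices; symmetrizing its coefficients changes nothing on
  -- symmetric ones.
  set G : Matrix ι ι ℝ := Matrix.of fun i j => (f (single i j 1) + f (single j i 1)) / 2 with hGdef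
  have hGs : G.IsSymm := by
    ext i j
    simp [hGdef, add_comm]
  have hfG : ∀ W : Matrix ι ι ℝ, W.IsSymm → f W = (G * W).trace := by
    intro W hW
    have h1 : ∀ i j, W j i = W i j := fun i j => hW.apply i j
    have h2 : f W = ∑ i, ∑ j, W i j * f (single i j 1) := by
      conv_lhs => rw [matrix_eq_sum_single W]
      simp_rw [map_sum]
      refine Finset.sum_congr rfl fun i _ => Finset.sum_congr rfl fun j _ => ?_
      rw [← smul_eq_mul, ← map_smul, smul_single, smul_eq_mul, mul_one]
    have h3 : f W = ∑ i, ∑ j, W i j * f (single j i 1) := by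
      rw [h2, Finset.sum_comm]
      simp_rw [h1]
    have h4 : (G * W).trace = (∑ i, ∑ j, W i j * f (single i j 1)
        + ∑ i, ∑ j, W i j * f (single j i 1)) / 2 := by
      rw [trace, ← Finset.sum_add_distrib, Finset.sum_div]
      refine Finset.sum_congr rfl fun i _ => ?_
      rw [diag_apply, mul_apply, ← Finset.sum_add_distrib, Finset.sum_div]
      refine Finset.sum_congr rfl fun j _ => ?_
      rw [h1 i j, hGdef, of_apply]
      ring
    rw [h4, ← h2, ← h3]
    ring
  have hDs : ∀ W ∈ D, W.IsSymm := fun W hW => isHermitian_iff_isSymm.1 (h.posDef hW).isHermitian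
  have hfD' : ∀ W ∈ D, u < (G * W).trace := fun W hW => by
    rw [← hfG W (hDs W hW)]
    exact hfD W (subset_closure hW)
  have hGp : G.PosSemidef := by
    refine .of_dotProduct_mulVec_nonneg (isHermitian_iff_isSymm.2 hGs) fun v => ?_
    by_contra hneg
    rw [not_le] at hneg
    obtain ⟨W, hW⟩ := h.nonempty
    set q := star v ⬝ᵥ G *ᵥ v with hq
    -- The multiple of vvᵀ that brings trace(G·) from its value at W down to exactly u,
    -- contradicting strict separation.
    have hs : 0 ≤ ((G * W).trace - u) / (-q) :=
      div_nonneg (sub_nonneg.2 (hfD' W hW).le) (by linarith)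
    have := hfD' _ (h.add_mem W hW _ ((posSemidef_vecMulVec_self_star v).smul hs))
    rw [Matrix.mul_add, trace_add, Matrix.mul_smul, trace_smul, trace_mul_vecMulVec_star, ← hq,
      smul_eq_mul] at this
    have h5 : ((G * W).trace - u) / (-q) * q = -((G * W).trace - u) := by
      rw [div_neg, neg_mul, div_mul_cancel₀ _ hneg.ne]
    linarith
  have key : ∀ η : ℝ, 0 < η → u ≤ f V + η * V.trace := by
    intro η hη
    have h1 := hG (G + η • 1) (PosDef.posSemidef_add hGp (PosDef.one.smul hη))
    have hexp : ∀ W : Matrix ι ι ℝ, ((G + η • 1) * W).trace = (G * W).trace + η * W.trace := by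
      intro W
      rw [Matrix.add_mul, trace_add, smul_mul_assoc, Matrix.one_mul, trace_smul, smul_eq_mul]
    have h2 : u ≤ supportLevel D (G + η • 1) := h.le_supportLevel fun W hW => by
      rw [hexp]
      have := (h.posDef hW).posSemidef.trace_nonneg
      nlinarith [hfD' W hW]
    rw [hexp, ← hfG V hV] at h1
    exact h2.trans h1
  have ht : Filter.Tendsto (fun η : ℝ => f V + η * V.trace) (𝓝[>] 0)
      (𝓝 (f V + 0 * V.trace)) := by
    refine Filter.Tendsto.mono_left ?_ nhdsWithin_le_nhds
    exact (by fun_prop : Continuous fun η : ℝ => f V + η * V.trace).tendsto 0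
  have := ge_of_tendsto ht (eventually_nhdsWithin_of_forall fun η hη => key η hη)
  linarith

theorem invSet_subset (h : IsVarianceRegion D) : invSet D ⊆ supportedInvSet D := fun _ hJ =>
  mem_supportedInvSet_iff.2 ⟨hJ.1, h.subset_supportedSet hJ.2⟩

theorem supportedInvSet_nonempty (h : IsVarianceRegion D) : (supportedInvSet D).Nonempty :=
  let ⟨_, hV⟩ := h.nonempty
  ⟨_, inv_mem_supportedInvSet (h.subset_supportedSet hV)⟩

theorem supportedInvSet_subset_closure (h : IsVarianceRegion D) :
    supportedInvSet D ⊆ closure (invSet D) := by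
  intro J hJ
  have h1 : J⁻¹ ∈ closure D :=
    h.mem_closure_of_supported (isHermitian_iff_isSymm.1 hJ.1.inv.isHermitian) hJ.2
  have h2 := (continuousAt_inv_of_posDef hJ.1.inv).continuousWithinAt (s := D)
  have h3 := h2.mem_closure_image h1
  rw [inv_inv_of_posDef hJ.1] at h3
  refine closure_mono ?_ h3
  rintro _ ⟨V, hV, rfl⟩
  exact ⟨(h.posDef hV).inv, by rwa [inv_inv_of_posDef (h.posDef hV)]⟩

/-- Inversion is continuous at J, so the inequalities survive the limit; definiteness is assumed
because a limit can be singular. -/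
theorem mem_supportedInvSet_of_mem_closure (h : IsVarianceRegion D) {J : Matrix ι ι ℝ}
    (hJ : J ∈ closure (invSet D)) (hJp : J.PosDef) : J ∈ supportedInvSet D := by
  refine ⟨hJp, fun G hG => ?_⟩
  have := mem_closure_iff_nhdsWithin_neBot.1 hJ
  have ht : Filter.Tendsto (fun A : Matrix ι ι ℝ => (G * A⁻¹).trace) (𝓝[invSet D] J)
      (𝓝 (G * J⁻¹).trace) :=
    ((by fun_prop : Continuous fun A : Matrix ι ι ℝ => (G * A).trace).continuousAt.comp
      (continuousAt_inv_of_posDef hJp)).tendsto.mono_left nhdsWithin_le_nhds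
  exact ge_of_tendsto ht (eventually_nhdsWithin_of_forall fun A hA =>
    (h.invSet_subset hA).2 G hG)

theorem convex_supportedInvSet (h : IsVarianceRegion D) : Convex ℝ (supportedInvSet D) := by
  intro J hJ J' hJ' a b ha hb hab
  refine h.mem_supportedInvSet_of_mem_closure
    (h.convex_inv.closure (h.supportedInvSet_subset_closure hJ)
      (h.supportedInvSet_subset_closure hJ') ha hb hab) ?_
  rcases ha.eq_or_lt with rfl | ha'
  · rw [zero_add] at hab
    subst hab
    simpa using hJ'.1
  · exact (hJ.1.smul ha').add_posSemidef (hJ'.1.posSemidef.smul hb)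

/-- The inequality in the direction G = JKJ reads ε trace(KJ²) ≤ trace(KJ). Together with trace(K(J
− ε⁻¹)²) ≥ 0 it yields the bound trace(K)/ε. -/
theorem exists_trace_mul_le (h : IsVarianceRegion D) {K : Matrix ι ι ℝ} (hK : K.PosDef) :
    ∃ c : ℝ, ∀ J ∈ supportedInvSet D, (K * J).trace ≤ c := by
  obtain ⟨ε, hε, hD⟩ := h.exists_le
  refine ⟨K.trace / ε, fun J hJ => ?_⟩
  have hu := isUnit_det_of_posDef hJ.1
  have hJs : Jᴴ = J := hJ.1.isHermitian.eq
  have hG : (J * K * J).PosDef := by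
    have := hK.conjTranspose_mul_mul_same (B := J) ?_
    · rwa [hJs] at this
    · exact mulVec_injective_of_isUnit hJ.1.isUnit
  have h1 := (h.le_supportLevel fun V hV =>
    trace_mul_le_of_posSemidef_sub_smul_one hG.posSemidef (hD V hV)).trans (hJ.2 _ hG)
  rw [Matrix.mul_assoc (J * K), mul_nonsing_inv J hu, Matrix.mul_one, trace_mul_comm J K] at h1
  have hsq : 0 ≤ (K * ((J - ε⁻¹ • (1 : Matrix ι ι ℝ)) * (J - ε⁻¹ • (1 : Matrix ι ι ℝ)))).trace := by
    have hh : (J - ε⁻¹ • (1 : Matrix ι ι ℝ)).IsHermitian :=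
      hJ.1.isHermitian.sub (isHermitian_one.smul (IsSelfAdjoint.all _))
    have := posSemidef_conjTranspose_mul_self (J - ε⁻¹ • (1 : Matrix ι ι ℝ))
    rw [hh.eq] at this
    exact trace_mul_nonneg_of_posSemidef hK.posSemidef this
  simp only [Matrix.mul_sub, Matrix.sub_mul, trace_sub, Matrix.mul_smul, Matrix.smul_mul,
    Matrix.mul_one, Matrix.one_mul, trace_smul, smul_eq_mul] at hsq
  rw [Matrix.mul_assoc, trace_mul_comm J, Matrix.mul_assoc] at h1
  have h2 : ε * ε⁻¹ = 1 := mul_inv_cancel₀ hε.ne'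
  have h3 := mul_nonneg hε.le hsq
  have h4 : ε * ((K * (J * J)).trace - ε⁻¹ * (K * J).trace - ε⁻¹ * ((K * J).trace - ε⁻¹ * K.trace))
      = ε * (K * (J * J)).trace - (ε * ε⁻¹) * (K * J).trace
        - (ε * ε⁻¹) * ((K * J).trace - ε⁻¹ * K.trace) := by ring
  rw [h4, h2] at h3
  rw [div_eq_mul_inv]
  linarith

/-- The supremum of `trace (K J)` over the inverses of the supported set. -/
theorem isLUB_sSup (h : IsVarianceRegion D) {K : Matrix ι ι ℝ} (hK : K.PosDef) :
    IsLUB ((fun J => (K * J).trace) '' supportedInvSet D)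
      (sSup ((fun J => (K * J).trace) '' supportedInvSet D)) := by
  obtain ⟨c, hc⟩ := h.exists_trace_mul_le hK
  refine isLUB_csSup (h.supportedInvSet_nonempty.image _) ⟨c, ?_⟩
  rintro _ ⟨J, hJ, rfl⟩
  exact hc J hJ

theorem isGLB_supportLevel (h : IsVarianceRegion D) (G : Matrix ι ι ℝ) (hG : G.PosDef) :
    IsGLB ((fun V => (G * V).trace) '' supportedSet D) (supportLevel D G) := by
  constructor
  · rintro _ ⟨V, hV, rfl⟩
    exact hV.2 G hG
  · intro b hb
    exact h.le_supportLevel fun V hV => hb ⟨V, h.subset_supportedSet hV, rfl⟩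

theorem posSemidef_of_mem_closure {J : Matrix ι ι ℝ} (hJ : J ∈ closure (invSet D)) :
    J.PosSemidef := by
  have hcl : IsClosed {J : Matrix ι ι ℝ | J.PosSemidef} := by
    have : {J : Matrix ι ι ℝ | J.PosSemidef}
        = {J | Jᴴ = J} ∩ ⋂ v : ι → ℝ, {J | 0 ≤ star v ⬝ᵥ J *ᵥ v} := by
      ext J
      simp only [posSemidef_iff_dotProduct_mulVec, Set.mem_inter_iff, Set.mem_iInter,
        Set.mem_ofPred_eq, Matrix.IsHermitian]
    rw [this]
    exact (isClosed_eq (by fun_prop) continuous_id).inter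
      (isClosed_iInter fun v => isClosed_le continuous_const (by fun_prop))
  exact closure_minimal (fun A hA => hA.1.posSemidef) hcl hJ

/-- A linear bound extends to singular limits; this is how the dual bounds reach measurements with
singular information. -/
theorem trace_mul_le_sSup_of_mem_closure (h : IsVarianceRegion D) {K J : Matrix ι ι ℝ}
    (hK : K.PosDef) (hJ : J ∈ closure (invSet D)) :
    (K * J).trace ≤ sSup ((fun J => (K * J).trace) '' supportedInvSet D) := by
  have hcl : IsClosed {J : Matrix ι ι ℝ |
      (K * J).trace ≤ sSup ((fun J => (K * J).trace) '' supportedInvSet D)} :=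
    isClosed_le (by fun_prop) continuous_const
  refine closure_minimal (fun A hA => ?_) hcl hJ
  exact (h.isLUB_sSup hK).1 ⟨A, h.invSet_subset hA, rfl⟩

/-- First-order optimality on a convex set: J₀ minimizes trace(G₀J⁻¹), so the one-sided derivative
towards any J is nonnegative. -/
theorem trace_mul_le_of_trace_mul_inv_eq (h : IsVarianceRegion D) {J₀ G₀ : Matrix ι ι ℝ}
    (hJ₀ : J₀ ∈ supportedInvSet D) (hG₀ : G₀.PosDef)
    (heq : (G₀ * J₀⁻¹).trace = supportLevel D G₀) {J : Matrix ι ι ℝ} (hJ : J ∈ supportedInvSet D) :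
    (J₀⁻¹ * G₀ * J₀⁻¹ * J).trace ≤ supportLevel D G₀ := by
  have hu := isUnit_det_of_posDef hJ₀.1
  set P : ℝ → Matrix ι ι ℝ := fun t => J₀ + t • (J - J₀) with hP
  have hmem : ∀ t ∈ Set.Ioo (0 : ℝ) 1, P t ∈ supportedInvSet D := fun t ht =>
    h.convex_supportedInvSet.add_smul_sub_mem hJ₀ hJ ⟨ht.1.le, ht.2.le⟩
  have key : ∀ t ∈ Set.Ioo (0 : ℝ) 1, 0 ≤ -(G₀ * ((P t)⁻¹ * (J - J₀) * J₀⁻¹)).trace := by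
    intro t ht
    have h1 := (hmem t ht).2 G₀ hG₀
    have hut := isUnit_det_of_posDef (hmem t ht).1
    -- The resolvent identity makes the difference quotient explicit, so continuity of the inverse
    -- replaces differentiation.
    have hdiff : (P t)⁻¹ - J₀⁻¹ = -(t • ((P t)⁻¹ * (J - J₀) * J₀⁻¹)) := by
      have : t • (J - J₀) = P t - J₀ := by simp [hP]
      rw [← Matrix.smul_mul, ← Matrix.mul_smul, this, Matrix.mul_sub, nonsing_inv_mul _ hut,
        Matrix.sub_mul, Matrix.one_mul, Matrix.mul_assoc, mul_nonsing_inv _ hu, Matrix.mul_one]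
      abel
    have h2 : (G₀ * (P t)⁻¹).trace - (G₀ * J₀⁻¹).trace
        = -(t * (G₀ * ((P t)⁻¹ * (J - J₀) * J₀⁻¹)).trace) := by
      rw [← trace_sub, ← Matrix.mul_sub, hdiff, Matrix.mul_neg, trace_neg, Matrix.mul_smul,
        trace_smul, smul_eq_mul]
    have h3 : 0 ≤ t * -(G₀ * ((P t)⁻¹ * (J - J₀) * J₀⁻¹)).trace := by linarith
    exact nonneg_of_mul_nonneg_right h3 ht.1
  have hP0 : P 0 = J₀ := by simp [hP]
  have hcont : ContinuousAt (fun t => -(G₀ * ((P t)⁻¹ * (J - J₀) * J₀⁻¹)).trace) 0 := by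
    have hPi : ContinuousAt (fun t => (P t)⁻¹) 0 := by
      refine ContinuousAt.comp (g := fun A : Matrix ι ι ℝ => A⁻¹) ?_ ?_
      · rw [hP0]; exact continuousAt_inv_of_posDef hJ₀.1
      · exact (by fun_prop : Continuous P).continuousAt
    exact (by fun_prop : Continuous fun A : Matrix ι ι ℝ =>
      -(G₀ * (A * (J - J₀) * J₀⁻¹)).trace).continuousAt.comp hPi
  have hlim := ge_of_tendsto (hcont.tendsto.mono_left nhdsWithin_le_nhds)
    (Filter.mem_of_superset (Ioo_mem_nhdsGT one_pos) key)
  rw [hP0, Matrix.mul_sub, nonsing_inv_mul _ hu, Matrix.sub_mul, Matrix.one_mul, Matrix.mul_sub,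
    trace_sub, heq, trace_mul_comm, Matrix.mul_assoc _ J₀⁻¹ G₀] at hlim
  have : (J₀⁻¹ * G₀ * J₀⁻¹ * J).trace = (J₀⁻¹ * J * (J₀⁻¹ * G₀)).trace := by
    rw [Matrix.mul_assoc (J₀⁻¹ * G₀), trace_mul_comm]
  linarith

theorem sSup_eq_supportLevel (h : IsVarianceRegion D) {J₀ G₀ : Matrix ι ι ℝ}
    (hJ₀ : J₀ ∈ supportedInvSet D) (hG₀ : G₀.PosDef)
    (heq : (G₀ * J₀⁻¹).trace = supportLevel D G₀) :
    sSup ((fun J => (J₀⁻¹ * G₀ * J₀⁻¹ * J).trace) '' supportedInvSet D) = supportLevel D G₀ := by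
  refine IsLUB.csSup_eq ⟨?_, fun b hb => ?_⟩ (h.supportedInvSet_nonempty.image _)
  · rintro _ ⟨J, hJ, rfl⟩
    exact h.trace_mul_le_of_trace_mul_inv_eq hJ₀ hG₀ heq hJ
  · refine le_trans (le_of_eq ?_) (hb ⟨J₀, hJ₀, rfl⟩)
    dsimp only
    rw [Matrix.mul_assoc, nonsing_inv_mul _ (isUnit_det_of_posDef hJ₀.1), Matrix.mul_one,
      trace_mul_comm, heq]

/-- With C the supremum, the completed square gives trace(J₀K₀J₀V) ≥ 2 trace(K₀J₀) − trace(K₀V⁻¹) ≥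
2C − C for V in D. The value at J₀⁻¹ gives the opposite inequality. -/
theorem supportLevel_eq_sSup (h : IsVarianceRegion D) {J₀ K₀ : Matrix ι ι ℝ}
    (hJ₀ : J₀ ∈ supportedInvSet D) (hK₀ : K₀.PosDef)
    (heq : (K₀ * J₀).trace = sSup ((fun J => (K₀ * J).trace) '' supportedInvSet D)) :
    supportLevel D (J₀ * K₀ * J₀) = sSup ((fun J => (K₀ * J).trace) '' supportedInvSet D) := by
  have hu := isUnit_det_of_posDef hJ₀.1
  have hJs : J₀ᴴ = J₀ := hJ₀.1.isHermitian.eq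
  have hG : (J₀ * K₀ * J₀).PosDef := by
    have := hK₀.conjTranspose_mul_mul_same (B := J₀) ?_
    · rwa [hJs] at this
    · exact mulVec_injective_of_isUnit hJ₀.1.isUnit
  apply le_antisymm
  · have := hJ₀.2 _ hG
    rwa [Matrix.mul_assoc (J₀ * K₀), mul_nonsing_inv J₀ hu, Matrix.mul_one, trace_mul_comm J₀ K₀,
      heq] at this
  · refine h.le_supportLevel fun V hV => ?_
    have hVp := h.posDef hV
    have h1 := (h.isLUB_sSup hK₀).1 ⟨V⁻¹, inv_mem_supportedInvSet (h.subset_supportedSet hV), rfl⟩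
    dsimp only at h1
    have hh : (V⁻¹ - J₀).IsHermitian := hVp.inv.isHermitian.sub hJ₀.1.isHermitian
    have h2 : 0 ≤ (K₀ * ((V⁻¹ - J₀) * V * (V⁻¹ - J₀))).trace := by
      have := hVp.posSemidef.conjTranspose_mul_mul_same (V⁻¹ - J₀)
      rw [hh.eq] at this
      exact trace_mul_nonneg_of_posSemidef hK₀.posSemidef this
    rw [trace_mul_square hVp] at h2
    linarith

/-- The supporting plane at V⁻¹, with normal K = VGV, also bounds W⁻¹. Hence the square built from
W⁻¹ − V⁻¹ has nonpositive trace against K and must vanish. -/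
theorem eq_of_trace_mul_eq (h : IsVarianceRegion D) {G V W : Matrix ι ι ℝ} (hG : G.PosDef)
    (hV : V ∈ supportedSet D) (hW : W ∈ supportedSet D) (hGV : (G * V).trace = supportLevel D G)
    (hGW : (G * W).trace = supportLevel D G) : W = V := by
  have huV := isUnit_det_of_posDef hV.1
  have hVs : Vᴴ = V := hV.1.isHermitian.eq
  have h1 := h.trace_mul_le_of_trace_mul_inv_eq (inv_mem_supportedInvSet hV) hG
    (by rwa [inv_inv_of_posDef hV.1]) (inv_mem_supportedInvSet hW)
  rw [inv_inv_of_posDef hV.1] at h1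
  have hK : (V * G * V).PosDef := by
    have := hG.conjTranspose_mul_mul_same (B := V) ?_
    · rwa [hVs] at this
    · exact mulVec_injective_of_isUnit hV.1.isUnit
  have hh : (W⁻¹ - V⁻¹).IsHermitian := hW.1.inv.isHermitian.sub hV.1.inv.isHermitian
  have h2 := trace_mul_square (K := V * G * V) (A := V⁻¹) hW.1
  have h3 : (V * G * V * V⁻¹).trace = (G * V).trace := by
    rw [Matrix.mul_assoc (V * G), mul_nonsing_inv V huV, Matrix.mul_one, trace_mul_comm]
  have h4 : V⁻¹ * (V * G * V) * V⁻¹ = G := by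
    rw [Matrix.mul_assoc, Matrix.mul_assoc (V * G), mul_nonsing_inv V huV, Matrix.mul_one,
      ← Matrix.mul_assoc, nonsing_inv_mul V huV, Matrix.one_mul]
  rw [h3, h4, hGV, hGW] at h2
  have h5 : 0 ≤ (V * G * V * ((W⁻¹ - V⁻¹) * W * (W⁻¹ - V⁻¹))).trace := by
    have := hW.1.posSemidef.conjTranspose_mul_mul_same (W⁻¹ - V⁻¹)
    rw [hh.eq] at this
    exact trace_mul_nonneg_of_posSemidef hK.posSemidef this
  have h6 := eq_zero_of_trace_mul_mul_mul_eq_zero hK hW.1 hh (by linarith)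
  rw [← inv_inv_of_posDef hV.1, ← inv_inv_of_posDef hW.1, sub_eq_zero.1 h6]

theorem mem_supportedSet_iff (h : IsVarianceRegion D) {V : Matrix ι ι ℝ} :
    V ∈ supportedSet D ↔
      V.IsSymm ∧ ∀ G : Matrix ι ι ℝ, G.PosDef → supportLevel D G ≤ (G * V).trace := by
  obtain ⟨ε, hε, hD⟩ := h.exists_le_of_supported
  exact ⟨fun hV => ⟨isHermitian_iff_isSymm.1 hV.1.isHermitian, hV.2⟩, fun hV =>
    ⟨posDef_of_posSemidef_sub_smul_one hε (hD V hV.1 hV.2), hV.2⟩⟩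

theorem isClosed_supportedSet (h : IsVarianceRegion D) : IsClosed (supportedSet D) := by
  have : supportedSet D = {V : Matrix ι ι ℝ | Vᵀ = V} ∩ ⋂ G : Matrix ι ι ℝ, ⋂ _ : G.PosDef,
      {V | supportLevel D G ≤ (G * V).trace} := by
    ext V
    simp only [h.mem_supportedSet_iff, Set.mem_inter_iff, Set.mem_iInter, Set.mem_ofPred_eq,
      Matrix.IsSymm]
  rw [this]
  exact (isClosed_eq (by fun_prop) continuous_id).inter (isClosed_iInter fun G =>
    isClosed_iInter fun _ => isClosed_le continuous_const (by fun_prop))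

theorem isCompact_supportedSet_inter (h : IsVarianceRegion D) {G : Matrix ι ι ℝ} (hG : G.PosDef)
    (c : ℝ) : IsCompact (supportedSet D ∩ {V | (G * V).trace ≤ c}) := by
  obtain ⟨κ, hκ⟩ := exists_trace_le_mul_trace_mul hG
  have hbox : IsCompact {V : Matrix ι ι ℝ | ∀ i j, V i j ∈ Set.Icc (-(|κ| * c)) (|κ| * c)} := by
    have := isCompact_univ_pi (X := fun _ : ι => ι → ℝ) fun _ => isCompact_univ_pi
      (X := fun _ : ι => ℝ) fun _ => isCompact_Icc (a := -(|κ| * c)) (b := |κ| * c)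
    refine this.of_isClosed_subset ?_ ?_
    · simp only [Set.ofPred_forall]
      exact isClosed_iInter fun i => isClosed_iInter fun j =>
        isClosed_Icc.preimage (by fun_prop : Continuous fun V : Matrix ι ι ℝ => V i j)
    · intro V hV i _ j _
      exact hV i j
  refine hbox.of_isClosed_subset (h.isClosed_supportedSet.inter
    (isClosed_le (by fun_prop) continuous_const)) ?_
  rintro V ⟨hV, hVc⟩ i j
  have h0 := trace_mul_nonneg_of_posSemidef hG.posSemidef hV.1.posSemidef
  have h1 : V.trace ≤ |κ| * c := (hκ V hV.1.posSemidef).trans <|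
    (mul_le_mul_of_nonneg_right (le_abs_self κ) h0).trans
      (mul_le_mul_of_nonneg_left hVc (abs_nonneg κ))
  exact abs_le.1 ((abs_apply_le_trace hV.1.posSemidef i j).trans h1)

theorem existsUnique_trace_mul_eq (h : IsVarianceRegion D) {G : Matrix ι ι ℝ} (hG : G.PosDef) :
    ∃! V : Matrix ι ι ℝ, V ∈ supportedSet D ∧ (G * V).trace = supportLevel D G := by
  obtain ⟨W, hW⟩ := h.nonempty
  have hWs := h.subset_supportedSet hW
  obtain ⟨V, ⟨hV, hVc⟩, hmin⟩ := (h.isCompact_supportedSet_inter hG (G * W).trace).exists_isMinOn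
    ⟨W, hWs, le_refl (G * W).trace⟩ (f := fun V => (G * V).trace)
    (by fun_prop : Continuous fun V : Matrix ι ι ℝ => (G * V).trace).continuousOn
  have heq : (G * V).trace = supportLevel D G := by
    -- V is minimal only within the sublevel set through W; members of D outside it have larger
    -- values anyway.
    refine le_antisymm (h.le_supportLevel fun V' hV' => ?_) (hV.2 G hG)
    by_cases hc : (G * V').trace ≤ (G * W).trace
    · exact hmin ⟨h.subset_supportedSet hV', hc⟩
    · exact hVc.trans (not_le.1 hc).le
  exact ⟨V, ⟨hV, heq⟩, fun V' hV' => h.eq_of_trace_mul_eq hG hV hV'.1 heq hV'.2⟩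

end IsVarianceRegion

end VarianceRegion

/-! ### Symmetric logarithmic derivatives and Cauchy–Schwarz -/

section LogarithmicDerivative

variable {n : Type*} [Fintype n]

/-- Cauchy–Schwarz for the semi-inner product Re trace(σA*mB), via the discriminant. -/
theorem trace_mul_re_sq_le {σ m : Matrix n n ℂ} (hσ : σ.PosSemidef) (hm : m.PosSemidef)
    (A B : Matrix n n ℂ) :
    (σ * (Aᴴ * m * B)).trace.re ^ 2 ≤
      (σ * (Aᴴ * m * A)).trace.re * (σ * (Bᴴ * m * B)).trace.re := by
  have hsymm : (σ * (Bᴴ * m * A)).trace.re = (σ * (Aᴴ * m * B)).trace.re := by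
    have : (σ * (Bᴴ * m * A)).trace = star (σ * (Aᴴ * m * B)).trace := by
      rw [← trace_conjTranspose]
      simp only [conjTranspose_mul, hσ.isHermitian.eq, hm.isHermitian.eq,
        conjTranspose_conjTranspose]
      rw [trace_mul_comm]
      simp only [Matrix.mul_assoc]
    rw [this]
    simp
  have key : ∀ t : ℝ, 0 ≤ (σ * (Aᴴ * m * A)).trace.re * (t * t)
      + 2 * (σ * (Aᴴ * m * B)).trace.re * t + (σ * (Bᴴ * m * B)).trace.re := by
    intro t
    have h0 := (Complex.le_def.1 (trace_mul_nonneg_of_posSemidef hσ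
      (hm.conjTranspose_mul_mul_same ((t : ℂ) • A + B)))).1
    simp only [conjTranspose_add, conjTranspose_smul, Matrix.add_mul, Matrix.mul_add,
      Matrix.smul_mul, Matrix.mul_smul, trace_add, trace_smul, Complex.star_def,
      Complex.conj_ofReal, smul_eq_mul, Complex.add_re, Complex.re_ofReal_mul, Complex.zero_re,
      hsymm] at h0
    linarith
  have := discrim_le_zero key
  rw [discrim] at this
  nlinarith

variable [DecidableEq n]

/-- The symmetric logarithmic derivative. -/
theorem exists_isHermitian_mul_add_mul_eq {σ δ : Matrix n n ℂ} (hσ : σ.PosSemidef)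
    (hδ : δ.IsHermitian) (hker : ∀ v, σ *ᵥ v = 0 → star v ⬝ᵥ δ *ᵥ v = 0) :
    ∃ L : Matrix n n ℂ, L.IsHermitian ∧ σ * L + L * σ = (2 : ℂ) • δ := by
  set U : Matrix n n ℂ := hσ.1.eigenvectorUnitary.1 with hU
  have hUU : Uᴴ * U = 1 := Unitary.coe_star_mul_self hσ.1.eigenvectorUnitary
  have hUU' : U * Uᴴ = 1 := Unitary.coe_mul_star_self hσ.1.eigenvectorUnitary
  set l : n → ℝ := hσ.1.eigenvalues with hl
  have hl0 : ∀ i, 0 ≤ l i := hσ.eigenvalues_nonneg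
  set Λ : Matrix n n ℂ := diagonal fun i => (l i : ℂ) with hΛ
  have hspec : σ = U * Λ * Uᴴ := hσ.1.spectral_theorem
  set δ' : Matrix n n ℂ := Uᴴ * δ * U with hδ'
  have hδ'h : δ'.IsHermitian := isHermitian_conjTranspose_mul_mul U hδ
  have hquad : ∀ x : n → ℂ, Λ *ᵥ x = 0 → star x ⬝ᵥ δ' *ᵥ x = 0 := by
    intro x hx
    have h1 := hker (U *ᵥ x) (by
      rw [hspec, mulVec_mulVec, Matrix.mul_assoc, hUU, Matrix.mul_one, ← mulVec_mulVec, hx,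
        mulVec_zero])
    rwa [star_mulVec, ← dotProduct_mulVec, mulVec_mulVec, mulVec_mulVec] at h1
  -- Polarization with coefficients 1 and i: the quadratic form vanishes on the kernel, so the whole
  -- block does.
  have hzero : ∀ i j, l i = 0 → l j = 0 → δ' i j = 0 := by
    intro i j hi hj
    have hker' : ∀ k, l k = 0 → Λ *ᵥ Pi.single k 1 = 0 := by
      intro k hk
      rw [hΛ, diagonal_mulVec_single, hk]
      simp
    have hpol : ∀ c : ℂ, star (Pi.single i 1 + c • Pi.single j 1 : n → ℂ) ⬝ᵥ
        δ' *ᵥ (Pi.single i 1 + c • Pi.single j 1) = 0 := fun c =>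
      hquad _ (by rw [mulVec_add, mulVec_smul, hker' i hi, hker' j hj, smul_zero, add_zero])
    have hii := hquad _ (hker' i hi)
    have hjj := hquad _ (hker' j hj)
    have h1 := hpol 1
    have hI := hpol Complex.I
    simp [mulVec_add, mulVec_smul] at hii hjj h1 hI
    simp [hii, hjj] at h1 hI
    have h2 : δ' i j = δ' j i := by
      have h3 : Complex.I * (δ' i j - δ' j i) = 0 := by linear_combination hI
      have := (mul_eq_zero.1 h3).resolve_left Complex.I_ne_zero
      exact sub_eq_zero.1 this
    have h4 : 2 * δ' i j = 0 := by
      rw [two_mul]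
      nth_rewrite 2 [h2]
      linear_combination h1
    simpa using h4
  -- Entrywise solution in an eigenbasis of σ. On the kernel block the division by zero returns 0,
  -- which is correct because `hzero` makes the right-hand side vanish there.
  set L' : Matrix n n ℂ := Matrix.of fun i j => 2 * δ' i j / ((l i : ℂ) + l j) with hL'
  have hL'h : L'.IsHermitian := by
    ext i j
    have := hδ'h.apply i j
    simp only [hL', conjTranspose_apply, of_apply, star_div₀, star_mul', this, star_add,
      Complex.star_def, Complex.conj_ofReal]
    rw [add_comm]
    simp [← this, Complex.conj_ofNat]
  have hsyl : Λ * L' + L' * Λ = (2 : ℂ) • δ' := by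
    ext i j
    simp only [hΛ, Matrix.add_apply, diagonal_mul, mul_diagonal, hL', of_apply, Matrix.smul_apply,
      smul_eq_mul]
    by_cases h : l i + l j = 0
    · have hi : l i = 0 := by linarith [hl0 i, hl0 j]
      have hj : l j = 0 := by linarith [hl0 i, hl0 j]
      simp [hi, hj, hzero i j hi hj]
    · have : (l i : ℂ) + l j ≠ 0 := by exact_mod_cast h
      field_simp
  refine ⟨U * L' * Uᴴ, isHermitian_mul_mul_conjTranspose U hL'h, ?_⟩
  have h1 : σ * (U * L' * Uᴴ) = U * (Λ * L') * Uᴴ := by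
    calc σ * (U * L' * Uᴴ) = U * Λ * (Uᴴ * U) * L' * Uᴴ := by
          rw [hspec]; simp only [Matrix.mul_assoc]
      _ = _ := by rw [hUU]; simp only [Matrix.mul_assoc, Matrix.one_mul]
  have h2 : (U * L' * Uᴴ) * σ = U * (L' * Λ) * Uᴴ := by
    calc (U * L' * Uᴴ) * σ = U * L' * (Uᴴ * U) * Λ * Uᴴ := by
          rw [hspec]; simp only [Matrix.mul_assoc]
      _ = _ := by rw [hUU]; simp only [Matrix.mul_assoc, Matrix.one_mul]
  rw [h1, h2, ← Matrix.add_mul, ← Matrix.mul_add, hsyl, hδ', Matrix.mul_smul, Matrix.smul_mul]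
  congr 1
  calc U * (Uᴴ * δ * U) * Uᴴ = (U * Uᴴ) * δ * (U * Uᴴ) := by simp only [Matrix.mul_assoc]
    _ = δ := by rw [hUU', Matrix.one_mul, Matrix.mul_one]

omit [DecidableEq n] in
theorem trace_mul_re_eq_of_mul_add_mul_eq {σ δ L X : Matrix n n ℂ} (hσ : σ.IsHermitian)
    (hL : L.IsHermitian) (h : σ * L + L * σ = (2 : ℂ) • δ) (hX : X.IsHermitian) :
    (δ * X).trace.re = (σ * L * X).trace.re := by
  have h1 : (L * σ * X).trace = star (σ * L * X).trace := by
    rw [← trace_conjTranspose]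
    simp only [conjTranspose_mul, hσ.eq, hL.eq, hX.eq]
    rw [trace_mul_comm]
  have h2 : (2 : ℂ) * (δ * X).trace = (σ * L * X).trace + star (σ * L * X).trace := by
    rw [← h1, ← trace_add, ← Matrix.add_mul, h, Matrix.smul_mul, trace_smul, smul_eq_mul]
  have h3 := congrArg Complex.re h2
  simp at h3
  linarith

/-- The Fisher information of an outcome is bounded through the logarithmic derivative. -/
theorem exists_posSemidef_trace_sq_le {σ δ : Matrix n n ℂ} (hσ : σ.PosSemidef)
    (hδ : δ.IsHermitian) (hker : ∀ v, σ *ᵥ v = 0 → star v ⬝ᵥ δ *ᵥ v = 0) :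
    ∃ T : Matrix n n ℂ, T.PosSemidef ∧ ∀ m : Matrix n n ℂ, m.PosSemidef →
      (δ * m).trace.re ^ 2 ≤ (T * m).trace.re * (σ * m).trace.re := by
  obtain ⟨L, hL, h⟩ := exists_isHermitian_mul_add_mul_eq hσ hδ hker
  -- This T does not depend on m, so trace(T m(x)) can later serve as an integrable majorant of the
  -- squared derivative of a density divided by the density.
  refine ⟨L * σ * L, ?_, fun m hm => ?_⟩
  · have := hσ.conjTranspose_mul_mul_same L
    rwa [hL.eq] at this
  · have := trace_mul_re_sq_le hσ hm L 1
    rw [trace_mul_re_eq_of_mul_add_mul_eq hσ.isHermitian hL h hm.isHermitian]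
    rw [conjTranspose_one, Matrix.one_mul, Matrix.mul_one, Matrix.mul_one, hL.eq,
      ← Matrix.mul_assoc] at this
    convert this using 3
    rw [← Matrix.mul_assoc, ← Matrix.mul_assoc, trace_mul_comm _ L]
    simp only [Matrix.mul_assoc]

theorem exists_trace_sq_le {σ δ : Matrix n n ℂ} (hσ : σ.PosSemidef)
    (hδ : δ.IsHermitian) (hker : ∀ v, σ *ᵥ v = 0 → star v ⬝ᵥ δ *ᵥ v = 0) :
    ∃ β : ℝ, 0 ≤ β ∧ ∀ X : Matrix n n ℂ, X.IsHermitian →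
      (δ * X).trace.re ^ 2 ≤ β * (σ * (X * X)).trace.re := by
  obtain ⟨L, hL, h⟩ := exists_isHermitian_mul_add_mul_eq hσ hδ hker
  refine ⟨(σ * (L * L)).trace.re, ?_, fun X hX => ?_⟩
  · have := (posSemidef_conjTranspose_mul_self L)
    rw [hL.eq] at this
    exact (Complex.le_def.1 (trace_mul_nonneg_of_posSemidef hσ this)).1
  · have := trace_mul_re_sq_le hσ PosSemidef.one L X
    rw [trace_mul_re_eq_of_mul_add_mul_eq hσ.isHermitian hL h hX]
    simpa only [hL.eq, hX.eq, Matrix.mul_one, ← Matrix.mul_assoc] using this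

end LogarithmicDerivative

/-! ### Derivative of the state -/

section Derivative

variable {p : ℕ} {n : Type*} [Fintype n] {ρ : EuclideanSpace ℝ (Fin p) → Matrix n n ℂ}
  {θ : EuclideanSpace ℝ (Fin p)}

/-- The matrix of the partial derivatives of the entries. -/
noncomputable def stateDeriv (ρ : EuclideanSpace ℝ (Fin p) → Matrix n n ℂ)
    (θ : EuclideanSpace ℝ (Fin p)) (i : Fin p) : Matrix n n ℂ :=
  Matrix.of fun a b => partialDeriv (fun t => ρ t a b) θ i

theorem hasFDerivAt_trace_mul (hdiff : ∀ a b, DifferentiableAt ℝ (fun t => ρ t a b) θ)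
    (X : Matrix n n ℂ) :
    HasFDerivAt (fun t => (ρ t * X).trace)
      (∑ a, ∑ b, X b a • fderiv ℝ (fun t => ρ t a b) θ) θ := by
  have : (fun t => (ρ t * X).trace) = fun t => ∑ a, ∑ b, ρ t a b * X b a := by
    funext t
    simp [trace, mul_apply]
  rw [this]
  exact HasFDerivAt.fun_sum fun a _ => HasFDerivAt.fun_sum fun b _ =>
    (hdiff a b).hasFDerivAt.mul_const (X b a)

theorem partialDeriv_trace_mul (hdiff : ∀ a b, DifferentiableAt ℝ (fun t => ρ t a b) θ)
    (X : Matrix n n ℂ) (i : Fin p) :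
    partialDeriv (fun t => (ρ t * X).trace) θ i = (stateDeriv ρ θ i * X).trace := by
  rw [partialDeriv, (hasFDerivAt_trace_mul hdiff X).fderiv]
  simp [trace, mul_apply, stateDeriv, partialDeriv, mul_comm]

theorem partialDeriv_trace_mul_re (hdiff : ∀ a b, DifferentiableAt ℝ (fun t => ρ t a b) θ)
    (X : Matrix n n ℂ) (i : Fin p) :
    partialDeriv (fun t => (ρ t * X).trace.re) θ i = (stateDeriv ρ θ i * X).trace.re := by
  rw [← partialDeriv_trace_mul hdiff X i, partialDeriv, partialDeriv]
  have h := Complex.reCLM.hasFDerivAt.comp θ (hasFDerivAt_trace_mul hdiff X).differentiableAt.hasFDerivAt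
  have h' : HasFDerivAt (fun t => (ρ t * X).trace.re) _ θ := h
  rw [h'.fderiv]
  rfl

omit [Fintype n] in
theorem stateDeriv_isHermitian (hpos : ∀ᶠ t in 𝓝 θ, (ρ t).IsHermitian) (i : Fin p) :
    (stateDeriv ρ θ i).IsHermitian := by
  ext a b
  have h : (fun t => ρ t a b) =ᶠ[𝓝 θ] fun t => star (ρ t b a) := by
    filter_upwards [hpos] with t ht
    exact (ht.apply a b).symm
  simp only [stateDeriv, conjTranspose_apply, of_apply, partialDeriv]
  rw [h.fderiv_eq, fderiv_star]
  simp

theorem trace_stateDeriv [DecidableEq n] (hdiff : ∀ a b, DifferentiableAt ℝ (fun t => ρ t a b) θ)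
    (htr : ∀ᶠ t in 𝓝 θ, (ρ t).trace = 1) (i : Fin p) : (stateDeriv ρ θ i).trace = 0 := by
  have h := partialDeriv_trace_mul hdiff 1 i
  rw [Matrix.mul_one] at h
  rw [← h, partialDeriv]
  have h' : (fun t => (ρ t * 1).trace) =ᶠ[𝓝 θ] fun _ => (1 : ℂ) := by
    filter_upwards [htr] with t ht
    rw [Matrix.mul_one, ht]
  rw [h'.fderiv_eq]
  simp

/-- The function t ↦ ⟨v, ρ(t)v⟩ is nonnegative near θ and zero at θ, so θ is a local minimum and the
derivative vanishes. -/
theorem stateDeriv_quadratic_eq_zero (hdiff : ∀ a b, DifferentiableAt ℝ (fun t => ρ t a b) θ)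
    (hpos : ∀ᶠ t in 𝓝 θ, (ρ t).PosSemidef) (i : Fin p) (v : n → ℂ) (hv : ρ θ *ᵥ v = 0) :
    star v ⬝ᵥ stateDeriv ρ θ i *ᵥ v = 0 := by
  have hre : (star v ⬝ᵥ stateDeriv ρ θ i *ᵥ v).re = 0 := by
    rw [← trace_mul_vecMulVec_star, ← partialDeriv_trace_mul_re hdiff, partialDeriv]
    have hmin : IsLocalMin (fun t => (ρ t * vecMulVec v (star v)).trace.re) θ := by
      filter_upwards [hpos] with t ht
      rw [trace_mul_vecMulVec_star, trace_mul_vecMulVec_star, hv, dotProduct_zero]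
      exact (Complex.le_def.1 (ht.dotProduct_mulVec_nonneg v)).1
    rw [hmin.fderiv_eq_zero]
    rfl
  have hH := stateDeriv_isHermitian (hpos.mono fun t ht => ht.isHermitian) i
  have him : (star v ⬝ᵥ stateDeriv ρ θ i *ᵥ v).im = 0 := hH.im_star_dotProduct_mulVec_self v
  exact Complex.ext hre him

end Derivative

/-! ### Real matrices viewed as complex ones -/

section RealMatrices

variable {ι : Type*} [Fintype ι]

omit [Fintype ι] in
theorem map_ofReal_isHermitian {A : Matrix ι ι ℝ} (hA : A.IsSymm) :
    (A.map (fun r : ℝ => (r : ℂ))).IsHermitian := by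
  ext i j
  simp [hA.apply i j]

theorem map_ofReal_posSemidef {A : Matrix ι ι ℝ} (hA : A.PosSemidef) :
    (A.map (fun r : ℝ => (r : ℂ))).PosSemidef := by
  obtain ⟨m, v, rfl⟩ := posSemidef_iff_eq_sum_vecMulVec.1 hA
  have : (∑ k, vecMulVec (v k) (star (v k))).map (fun r : ℝ => (r : ℂ))
      = ∑ k, vecMulVec (fun i => (v k i : ℂ)) (star fun i => (v k i : ℂ)) := by
    ext i j
    simp [Matrix.sum_apply, vecMulVec_apply]
  rw [this]
  exact posSemidef_sum _ fun k _ => posSemidef_vecMulVec_self_star _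

theorem map_ofReal_mul (A B : Matrix ι ι ℝ) :
    (A * B).map (fun r : ℝ => (r : ℂ))
      = A.map (fun r : ℝ => (r : ℂ)) * B.map (fun r : ℝ => (r : ℂ)) := by
  ext i j
  simp [mul_apply]

theorem re_dotProduct_map_ofReal_mulVec (A : Matrix ι ι ℝ) (c : ι → ℝ) :
    (star (fun i => (c i : ℂ)) ⬝ᵥ A.map (fun r : ℝ => (r : ℂ)) *ᵥ fun i => (c i : ℂ)).re
      = c ⬝ᵥ A *ᵥ c := by
  have : star (fun i => (c i : ℂ)) ⬝ᵥ A.map (fun r : ℝ => (r : ℂ)) *ᵥ (fun i => (c i : ℂ))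
      = ((c ⬝ᵥ A *ᵥ c : ℝ) : ℂ) := by
    simp [dotProduct, mulVec]
  rw [this, Complex.ofReal_re]

end RealMatrices

/-! ### Attainable variances and informations on one copy -/

section SingleCopy

variable {p d : ℕ} {σ : Matrix (Fin d) (Fin d) ℂ} {δ X Y : Fin p → Matrix (Fin d) (Fin d) ℂ}

/-- Linear combinations of a tuple of matrices with the rows of a real matrix as coefficients. -/
def realComb (A : Matrix (Fin p) (Fin p) ℝ) (X : Fin p → Matrix (Fin d) (Fin d) ℂ) :
    Fin p → Matrix (Fin d) (Fin d) ℂ :=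
  fun i => ∑ j, (A i j : ℂ) • X j

theorem realComb_isHermitian (A : Matrix (Fin p) (Fin p) ℝ) (hX : ∀ j, (X j).IsHermitian)
    (i : Fin p) : (realComb A X i).IsHermitian := by
  rw [IsHermitian, realComb, conjTranspose_sum]
  exact Finset.sum_congr rfl fun j _ => by
    rw [conjTranspose_smul, (hX j).eq, Complex.star_def, Complex.conj_ofReal]

theorem trace_mul_realComb (A : Matrix (Fin p) (Fin p) ℝ) (M : Matrix (Fin d) (Fin d) ℂ)
    (i : Fin p) : (M * realComb A X i).trace = ∑ j, (A i j : ℂ) * (M * X j).trace := by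
  simp [realComb, Matrix.mul_sum, trace_sum]

theorem zMatrix_realComb (A : Matrix (Fin p) (Fin p) ℝ) :
    zMatrix σ (realComb A X) = A.map (fun r : ℝ => (r : ℂ)) * zMatrix σ X *
      (A.map (fun r : ℝ => (r : ℂ)))ᵀ := by
  ext i j
  simp only [zMatrix, realComb, of_apply, mul_apply, map_apply, transpose_apply,
    trace_sum, Matrix.mul_smul, Matrix.smul_mul, trace_smul, smul_eq_mul,
    Finset.sum_mul, Finset.mul_sum]
  exact Finset.sum_congr rfl fun k _ => Finset.sum_congr rfl fun l _ => by ring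

theorem dotProduct_zMatrix_mulVec (hX : ∀ j, (X j).IsHermitian) (c : Fin p → ℂ) :
    star c ⬝ᵥ zMatrix σ X *ᵥ c
      = (σ * ((∑ j, c j • X j)ᴴ * ∑ j, c j • X j)).trace := by
  simp only [dotProduct, mulVec, zMatrix, of_apply, conjTranspose_sum, conjTranspose_smul,
    (hX _).eq, Matrix.sum_mul, trace_sum, Matrix.mul_smul, Matrix.smul_mul,
    trace_smul, smul_eq_mul, Finset.mul_sum, Pi.star_apply]
  rw [Finset.sum_comm]
  exact Finset.sum_congr rfl fun k _ => Finset.sum_congr rfl fun l _ => by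
    rw [Matrix.mul_assoc]; ring

theorem zMatrix_isHermitian (hσ : σ.IsHermitian) (hX : ∀ j, (X j).IsHermitian) :
    (zMatrix σ X).IsHermitian := by
  ext i j
  simp only [zMatrix, conjTranspose_apply, of_apply]
  rw [← trace_conjTranspose]
  simp only [conjTranspose_mul, hσ.eq, (hX _).eq]
  rw [← Matrix.mul_assoc, trace_mul_comm, Matrix.mul_assoc]

theorem zMatrix_posSemidef (hσ : σ.PosSemidef) (hX : ∀ j, (X j).IsHermitian) :
    (zMatrix σ X).PosSemidef :=
  .of_dotProduct_mulVec_nonneg (zMatrix_isHermitian hσ.isHermitian hX) fun c => by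
    rw [dotProduct_zMatrix_mulVec hX]
    exact trace_mul_nonneg_of_posSemidef hσ (posSemidef_conjTranspose_mul_self _)

/-- Z is quadratic, so its convexity defect is exactly ab·Z(X − Y). -/
theorem zMatrix_convex (hσ : σ.PosSemidef) (hX : ∀ j, (X j).IsHermitian)
    (hY : ∀ j, (Y j).IsHermitian) {a b : ℝ} (ha : 0 ≤ a) (hb : 0 ≤ b) (hab : a + b = 1) :
    (((a : ℂ) • zMatrix σ X + (b : ℂ) • zMatrix σ Y)
      - zMatrix σ fun j => (a : ℂ) • X j + (b : ℂ) • Y j).PosSemidef := by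
  have : ((a : ℂ) • zMatrix σ X + (b : ℂ) • zMatrix σ Y)
      - zMatrix σ (fun j => (a : ℂ) • X j + (b : ℂ) • Y j)
      = ((a * b : ℝ) : ℂ) • zMatrix σ (fun j => X j - Y j) := by
    obtain rfl : b = 1 - a := by linarith
    ext i j
    simp only [zMatrix, Matrix.sub_apply, Matrix.add_apply, Matrix.smul_apply, of_apply,
      Matrix.mul_add, Matrix.add_mul, Matrix.mul_sub, Matrix.sub_mul, trace_add, trace_sub,
      Matrix.mul_smul, Matrix.smul_mul, trace_smul, smul_eq_mul]
    push_cast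
    ring
  rw [this]
  exact (zMatrix_posSemidef hσ fun j => (hX j).sub (hY j)).smul
    (by exact_mod_cast mul_nonneg ha hb)

/-- The real symmetric matrices above `Z(X)` for some `X` that is locally unbiased in the
directions `δ`. -/
def attainableVariance (σ : Matrix (Fin d) (Fin d) ℂ) (δ : Fin p → Matrix (Fin d) (Fin d) ℂ) :
    Set (Matrix (Fin p) (Fin p) ℝ) :=
  {V | ∃ X : Fin p → Matrix (Fin d) (Fin d) ℂ, (∀ j, (X j).IsHermitian) ∧
    (∀ i j, (δ i * X j).trace = if i = j then 1 else 0) ∧ V.IsSymm ∧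
    (V.map (fun r : ℝ => (r : ℂ)) - zMatrix σ X).PosSemidef}

/-- The real symmetric matrices `J` above `Z(U)` for some `U` with derivatives
`trace (δ_i U_j) = J_ij`. -/
def attainableInformation (σ : Matrix (Fin d) (Fin d) ℂ)
    (δ : Fin p → Matrix (Fin d) (Fin d) ℂ) : Set (Matrix (Fin p) (Fin p) ℝ) :=
  {J | ∃ U : Fin p → Matrix (Fin d) (Fin d) ℂ, (∀ j, (U j).IsHermitian) ∧
    (∀ i j, (δ i * U j).trace = (J i j : ℂ)) ∧ J.IsSymm ∧
    (J.map (fun r : ℝ => (r : ℂ)) - zMatrix σ U).PosSemidef}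

theorem sub_zMatrix_realComb_posSemidef {A V : Matrix (Fin p) (Fin p) ℝ} (hA : A.IsSymm)
    (h : (V.map (fun r : ℝ => (r : ℂ)) - zMatrix σ X).PosSemidef) :
    ((A * V * A).map (fun r : ℝ => (r : ℂ)) - zMatrix σ (realComb A X)).PosSemidef := by
  have hAh := map_ofReal_isHermitian hA
  have h1 := h.mul_mul_conjTranspose_same (A.map fun r : ℝ => (r : ℂ))
  have h2 : (A.map fun r : ℝ => (r : ℂ))ᵀ = A.map fun r : ℝ => (r : ℂ) := by
    rw [← transpose_map, hA.eq]
  rw [zMatrix_realComb, map_ofReal_mul, map_ofReal_mul, h2, ← Matrix.sub_mul, ← Matrix.mul_sub]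
  rwa [hAh.eq] at h1

/-- Take U = V⁻¹X: its derivatives form V⁻¹, and conjugating V ≥ Z(X) by V⁻¹ gives V⁻¹ ≥ Z(U). -/
theorem inv_mem_attainableInformation {V : Matrix (Fin p) (Fin p) ℝ} (hVp : V.PosDef)
    (hV : V ∈ attainableVariance σ δ) : V⁻¹ ∈ attainableInformation σ δ := by
  obtain ⟨X, hX, hδ, -, hZ⟩ := hV
  have hs : V⁻¹.IsSymm := isHermitian_iff_isSymm.1 hVp.inv.isHermitian
  refine ⟨realComb V⁻¹ X, realComb_isHermitian _ hX, fun i j => ?_, hs, ?_⟩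
  · rw [trace_mul_realComb]
    simp [hδ, hs.apply i j]
  · have := sub_zMatrix_realComb_posSemidef hs hZ
    rwa [nonsing_inv_mul _ (isUnit_det_of_posDef hVp), Matrix.one_mul] at this

theorem inv_mem_attainableVariance {J : Matrix (Fin p) (Fin p) ℝ} (hJp : J.PosDef)
    (hJ : J ∈ attainableInformation σ δ) : J⁻¹ ∈ attainableVariance σ δ := by
  obtain ⟨U, hU, hδ, hJs, hZ⟩ := hJ
  have hs : J⁻¹.IsSymm := isHermitian_iff_isSymm.1 hJp.inv.isHermitian
  have hu := isUnit_det_of_posDef hJp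
  refine ⟨realComb J⁻¹ U, realComb_isHermitian _ hU, fun i j => ?_, hs, ?_⟩
  · rw [trace_mul_realComb]
    simp only [hδ]
    have h1 : (J * J⁻¹) i j = if i = j then 1 else 0 := by
      rw [mul_nonsing_inv _ hu, one_apply]
    rw [mul_apply] at h1
    have h2 : ∑ k, ((J⁻¹ j k : ℝ) : ℂ) * ((J i k : ℝ) : ℂ)
        = ((∑ k, J i k * J⁻¹ k j : ℝ) : ℂ) := by
      push_cast
      exact Finset.sum_congr rfl fun k _ => by rw [hs.apply, mul_comm]
    rw [h2, h1]
    split_ifs <;> simp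
  · have := sub_zMatrix_realComb_posSemidef hs hZ
    rwa [nonsing_inv_mul _ hu, Matrix.one_mul] at this

theorem mem_invSet_attainableVariance_iff {J : Matrix (Fin p) (Fin p) ℝ} :
    J ∈ invSet (attainableVariance σ δ) ↔ J.PosDef ∧ J ∈ attainableInformation σ δ :=
  ⟨fun h => ⟨h.1, by
    have := inv_mem_attainableInformation h.1.inv h.2
    rwa [inv_inv_of_posDef h.1] at this⟩,
    fun h => ⟨h.1, inv_mem_attainableVariance h.1 h.2⟩⟩

theorem map_comb (a b : ℝ) (V W : Matrix (Fin p) (Fin p) ℝ) :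
    (a • V + b • W).map (fun r : ℝ => (r : ℂ))
      = (a : ℂ) • V.map (fun r : ℝ => (r : ℂ)) + (b : ℂ) • W.map (fun r : ℝ => (r : ℂ)) := by
  ext i j
  simp

theorem comb_sub_zMatrix_posSemidef (hσ : σ.PosSemidef) (hX : ∀ j, (X j).IsHermitian)
    (hY : ∀ j, (Y j).IsHermitian) {a b : ℝ} (ha : 0 ≤ a) (hb : 0 ≤ b) (hab : a + b = 1)
    {V W : Matrix (Fin p) (Fin p) ℝ}
    (hV : (V.map (fun r : ℝ => (r : ℂ)) - zMatrix σ X).PosSemidef)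
    (hW : (W.map (fun r : ℝ => (r : ℂ)) - zMatrix σ Y).PosSemidef) :
    ((a • V + b • W).map (fun r : ℝ => (r : ℂ))
      - zMatrix σ fun j => (a : ℂ) • X j + (b : ℂ) • Y j).PosSemidef := by
  have h := ((hV.smul (show (0 : ℂ) ≤ (a : ℂ) by exact_mod_cast ha)).add
    (hW.smul (show (0 : ℂ) ≤ (b : ℂ) by exact_mod_cast hb))).add (zMatrix_convex hσ hX hY ha hb hab)
  convert h using 1
  rw [map_comb, smul_sub, smul_sub]
  abel

theorem comb_isHermitian {A B : Matrix (Fin d) (Fin d) ℂ} (hA : A.IsHermitian)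
    (hB : B.IsHermitian) (a b : ℝ) : ((a : ℂ) • A + (b : ℂ) • B).IsHermitian :=
  (hA.smul (Complex.conj_ofReal a)).add (hB.smul (Complex.conj_ofReal b))

theorem convex_attainableVariance (hσ : σ.PosSemidef) : Convex ℝ (attainableVariance σ δ) := by
  rintro V ⟨X, hX, hXδ, hVs, hVZ⟩ W ⟨Y, hY, hYδ, hWs, hWZ⟩ a b ha hb hab
  refine ⟨fun j => (a : ℂ) • X j + (b : ℂ) • Y j, fun j => comb_isHermitian (hX j) (hY j) a b,
    fun i j => ?_, (hVs.smul a).add (hWs.smul b),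
    comb_sub_zMatrix_posSemidef hσ hX hY ha hb hab hVZ hWZ⟩
  have : (a : ℂ) + b = 1 := by exact_mod_cast hab
  rw [Matrix.mul_add, trace_add, Matrix.mul_smul, Matrix.mul_smul, trace_smul, trace_smul, hXδ, hYδ,
    ← add_smul, this, one_smul]

/-- The derivative constraint is linear in the pair (J, U) and the matrix inequality is convex in
it. This is what makes the set of inverses convex. -/
theorem convex_attainableInformation (hσ : σ.PosSemidef) :
    Convex ℝ (attainableInformation σ δ) := by
  rintro V ⟨X, hX, hXδ, hVs, hVZ⟩ W ⟨Y, hY, hYδ, hWs, hWZ⟩ a b ha hb hab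
  refine ⟨fun j => (a : ℂ) • X j + (b : ℂ) • Y j, fun j => comb_isHermitian (hX j) (hY j) a b,
    fun i j => ?_, (hVs.smul a).add (hWs.smul b),
    comb_sub_zMatrix_posSemidef hσ hX hY ha hb hab hVZ hWZ⟩
  rw [Matrix.mul_add, trace_add, Matrix.mul_smul, Matrix.mul_smul, trace_smul, trace_smul, hXδ, hYδ]
  simp

theorem posSemidef_of_mem_attainableInformation (hσ : σ.PosSemidef) {J : Matrix (Fin p) (Fin p) ℝ}
    (hJ : J ∈ attainableInformation σ δ) : J.PosSemidef := by
  obtain ⟨U, hU, -, hJs, hZ⟩ := hJ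
  refine .of_dotProduct_mulVec_nonneg (isHermitian_iff_isSymm.2 hJs) fun c => ?_
  have h := hZ.add (zMatrix_posSemidef hσ hU)
  rw [sub_add_cancel] at h
  have := (Complex.le_def.1 (h.dotProduct_mulVec_nonneg fun i => (c i : ℂ))).1
  rwa [re_dotProduct_map_ofReal_mulVec] at this

/-- A Cramér–Rao argument: for A = Σ c_j X_j the constraints give trace(δ_i A) = c_i, so |c|² ≤ pβ
trace(σA²) ≤ pβ·cᵀVc. The 1 added to pβ keeps the constant positive when pβ = 0. -/
theorem exists_posSemidef_sub_smul_one {β : ℝ} (hβ : 0 ≤ β) (hσ : σ.PosSemidef)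
    (hδβ : ∀ i, ∀ X : Matrix (Fin d) (Fin d) ℂ, X.IsHermitian →
      (δ i * X).trace.re ^ 2 ≤ β * (σ * (X * X)).trace.re) :
    ∃ ε : ℝ, 0 < ε ∧ ∀ V ∈ attainableVariance σ δ, (V - ε • 1).PosSemidef := by
  have hpos : 0 < p * β + 1 := by positivity
  refine ⟨(p * β + 1)⁻¹, inv_pos.2 hpos, ?_⟩
  rintro V ⟨X, hX, hXδ, hVs, hZ⟩
  refine .of_dotProduct_mulVec_nonneg ((isHermitian_iff_isSymm.2 hVs).sub
    (isHermitian_one.smul (IsSelfAdjoint.all _))) fun c => ?_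
  set A : Matrix (Fin d) (Fin d) ℂ := ∑ j, (c j : ℂ) • X j with hA
  have hAh : A.IsHermitian := by
    rw [IsHermitian, hA, conjTranspose_sum]
    exact Finset.sum_congr rfl fun j _ => by
      rw [conjTranspose_smul, (hX j).eq, Complex.star_def, Complex.conj_ofReal]
  have h1 := (Complex.le_def.1 (hZ.dotProduct_mulVec_nonneg fun i => (c i : ℂ))).1
  rw [sub_mulVec, dotProduct_sub, Complex.sub_re, re_dotProduct_map_ofReal_mulVec,
    dotProduct_zMatrix_mulVec hX, ← hA, hAh.eq, Complex.zero_re] at h1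
  have h2 : ∀ i, (δ i * A).trace.re = c i := by
    intro i
    simp [hA, Matrix.mul_sum, trace_sum, hXδ]
  have h3 : c ⬝ᵥ c ≤ p * β * (σ * (A * A)).trace.re := by
    have : ∑ i : Fin p, c i * c i ≤ ∑ _i : Fin p, β * (σ * (A * A)).trace.re :=
      Finset.sum_le_sum fun i _ => by
        rw [← sq, ← h2 i]
        exact hδβ i A hAh
    simpa [dotProduct, mul_assoc] using this
  have h4 : 0 ≤ (σ * (A * A)).trace.re := by
    have := posSemidef_conjTranspose_mul_self A
    rw [hAh.eq] at this
    exact (Complex.le_def.1 (trace_mul_nonneg_of_posSemidef hσ this)).1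
  have h5 : (p * β + 1)⁻¹ * (c ⬝ᵥ c) ≤ c ⬝ᵥ V *ᵥ c := by
    rw [inv_mul_le_iff₀ hpos]
    have : 0 ≤ p * β := by positivity
    nlinarith
  rw [sub_mulVec, dotProduct_sub, smul_mulVec, one_mulVec, dotProduct_smul, smul_eq_mul,
    star_trivial]
  linarith

theorem isVarianceRegion_attainableVariance {β : ℝ} (hβ : 0 ≤ β) (hσ : σ.PosSemidef)
    (hδβ : ∀ i, ∀ X : Matrix (Fin d) (Fin d) ℂ, X.IsHermitian →
      (δ i * X).trace.re ^ 2 ≤ β * (σ * (X * X)).trace.re)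
    (hne : ∃ X : Fin p → Matrix (Fin d) (Fin d) ℂ, (∀ j, (X j).IsHermitian) ∧
      ∀ i j, (δ i * X j).trace = if i = j then 1 else 0) :
    IsVarianceRegion (attainableVariance σ δ) where
  nonempty := by
    obtain ⟨X, hX, hXδ⟩ := hne
    have hZ := zMatrix_posSemidef hσ hX
    -- The choice V = 2 Re Z works because V − Z is the complex conjugate of Z, that is Zᵀ ≥ 0.
    refine ⟨Matrix.of fun i j => 2 * (zMatrix σ X i j).re, X, hX, hXδ, ?_, ?_⟩
    · ext i j
      have := hZ.isHermitian.apply i j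
      simp [← this]
    · suffices h : (Matrix.of fun i j => 2 * (zMatrix σ X i j).re).map (fun r : ℝ => (r : ℂ))
          - zMatrix σ X = (zMatrix σ X)ᵀ by
        rw [h]
        exact hZ.transpose
      ext i j
      have := hZ.isHermitian.apply i j
      rw [transpose_apply, Matrix.sub_apply, map_apply, of_apply, ← this]
      apply Complex.ext
      · simp; ring
      · simp
  exists_le := exists_posSemidef_sub_smul_one hβ hσ hδβ
  convex := convex_attainableVariance hσ
  add_mem := by
    rintro V ⟨X, hX, hXδ, hVs, hZ⟩ W hW
    refine ⟨X, hX, hXδ, hVs.add (isHermitian_iff_isSymm.1 hW.isHermitian), ?_⟩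
    convert hZ.add (map_ofReal_posSemidef hW) using 1
    ext i j
    simp
    ring
  convex_inv := by
    have : {J : Matrix (Fin p) (Fin p) ℝ | J.PosDef ∧ J⁻¹ ∈ attainableVariance σ δ}
        = {J | J.PosDef} ∩ attainableInformation σ δ :=
      Set.ext fun J => mem_invSet_attainableVariance_iff
    rw [this]
    refine Convex.inter ?_ (convex_attainableInformation hσ)
    intro J hJ J' hJ' a b ha hb hab
    rcases ha.eq_or_lt with rfl | ha'
    · rw [zero_add] at hab
      subst hab
      simpa using hJ'
    · exact (PosDef.smul hJ ha').add_posSemidef ((PosDef.posSemidef hJ').smul hb)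

/-- On the segment from a possibly singular J towards some V⁻¹, every point other than J itself is
positive definite and still attainable. -/
theorem attainableInformation_subset_closure (hσ : σ.PosSemidef)
    (h : IsVarianceRegion (attainableVariance σ δ)) :
    attainableInformation σ δ ⊆ closure (invSet (attainableVariance σ δ)) := by
  intro J hJ
  obtain ⟨V, hV⟩ := h.nonempty
  have hVp := h.posDef hV
  have hJ0 := posSemidef_of_mem_attainableInformation hσ hJ
  have ht : Filter.Tendsto (fun t : ℝ => J + t • (V⁻¹ - J)) (𝓝[>] 0) (𝓝 (J + (0 : ℝ) • (V⁻¹ - J))) :=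
    ((by fun_prop : Continuous fun t : ℝ => J + t • (V⁻¹ - J)).tendsto 0).mono_left
      nhdsWithin_le_nhds
  rw [zero_smul, add_zero] at ht
  refine mem_closure_of_tendsto ht
    (Filter.mem_of_superset (Ioo_mem_nhdsGT one_pos) fun t ht => ?_)
  refine mem_invSet_attainableVariance_iff.2 ⟨?_, ?_⟩
  · have : J + t • (V⁻¹ - J) = (1 - t) • J + t • V⁻¹ := by module
    rw [this]
    exact PosDef.posSemidef_add (hJ0.smul (sub_nonneg.2 ht.2.le)) (hVp.inv.smul ht.1)
  · exact (convex_attainableInformation hσ).add_smul_sub_mem hJ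
      (inv_mem_attainableInformation hVp hV) ⟨ht.1.le, ht.2.le⟩

end SingleCopy

/-! ### Tensor powers and reduction to one site -/

section Tensor

variable {N d : ℕ}

/-- The tensor product of `N` matrices. -/
def tensorProd (A : Fin N → Matrix (Fin d) (Fin d) ℂ) :
    Matrix (Fin N → Fin d) (Fin N → Fin d) ℂ :=
  Matrix.of fun a b => ∏ k, A k (a k) (b k)

theorem tensorPower_eq_tensorProd (ρ : Matrix (Fin d) (Fin d) ℂ) :
    tensorPower N ρ = tensorProd fun _ => ρ := rfl

theorem tensorProd_mul (A B : Fin N → Matrix (Fin d) (Fin d) ℂ) :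
    tensorProd A * tensorProd B = tensorProd fun k => A k * B k := by
  ext a b
  simp only [tensorProd, mul_apply, of_apply, Finset.prod_univ_sum, Fintype.piFinset_univ,
    Finset.prod_mul_distrib]

theorem trace_tensorProd (A : Fin N → Matrix (Fin d) (Fin d) ℂ) :
    (tensorProd A).trace = ∏ k, (A k).trace := by
  simp only [trace, diag_apply, tensorProd, of_apply, Finset.prod_univ_sum, Fintype.piFinset_univ]

theorem conjTranspose_tensorProd (A : Fin N → Matrix (Fin d) (Fin d) ℂ) :
    (tensorProd A)ᴴ = tensorProd fun k => (A k)ᴴ := by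
  ext a b
  simp [tensorProd]

/-- A factorization ρ = B*B tensorizes. -/
theorem tensorPower_posSemidef {ρ : Matrix (Fin d) (Fin d) ℂ} (hρ : ρ.PosSemidef) :
    (tensorPower N ρ).PosSemidef := by
  open scoped MatrixOrder in
  obtain ⟨B, hB⟩ := CStarAlgebra.nonneg_iff_eq_star_mul_self.1 (nonneg_iff_posSemidef.2 hρ)
  rw [hB, tensorPower_eq_tensorProd, ← tensorProd_mul (fun _ => star B) fun _ => B]
  have : tensorProd (fun _ : Fin N => star B) = (tensorProd fun _ => B)ᴴ := by
    rw [conjTranspose_tensorProd]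
    rfl
  rw [this]
  exact posSemidef_conjTranspose_mul_self _

theorem tensorProd_update_apply (C : Fin N → Matrix (Fin d) (Fin d) ℂ) (k : Fin N)
    (B : Matrix (Fin d) (Fin d) ℂ) (a b : Fin N → Fin d) :
    tensorProd (Function.update C k B) a b
      = B (a k) (b k) * ∏ l ∈ Finset.univ.erase k, C l (a l) (b l) := by
  rw [tensorProd, of_apply, ← Finset.mul_prod_erase _ _ (Finset.mem_univ k),
    Function.update_self]
  congr 1
  exact Finset.prod_congr rfl fun l hl => by
    rw [Function.update_of_ne (Finset.ne_of_mem_erase hl)]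

/-- The tensor product as a linear function of one factor. -/
def tensorUpdate (C : Fin N → Matrix (Fin d) (Fin d) ℂ) (k : Fin N) :
    Matrix (Fin d) (Fin d) ℂ →ₗ[ℂ] Matrix (Fin N → Fin d) (Fin N → Fin d) ℂ where
  toFun B := tensorProd (Function.update C k B)
  map_add' A B := by
    ext a b
    simp only [tensorProd_update_apply, Matrix.add_apply, add_mul]
  map_smul' c B := by
    ext a b
    simp only [tensorProd_update_apply, Matrix.smul_apply, smul_eq_mul, mul_assoc, RingHom.id_apply]

theorem tensorUpdate_apply (C : Fin N → Matrix (Fin d) (Fin d) ℂ) (k : Fin N)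
    (B : Matrix (Fin d) (Fin d) ℂ) :
    tensorUpdate C k B = tensorProd (Function.update C k B) := rfl

theorem tensorUpdate_conjTranspose (C : Fin N → Matrix (Fin d) (Fin d) ℂ) (k : Fin N)
    (B : Matrix (Fin d) (Fin d) ℂ) :
    (tensorUpdate C k B)ᴴ = tensorUpdate (fun l => (C l)ᴴ) k Bᴴ := by
  rw [tensorUpdate_apply, tensorUpdate_apply, conjTranspose_tensorProd]
  congr 1
  funext l
  rcases eq_or_ne l k with rfl | h
  · simp
  · simp [h]

/-- The sum over the `N` sites of the partial traces of `Y` over the other sites, weighted with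
the state `ρ` there. -/
def siteTrace (ρ : Matrix (Fin d) (Fin d) ℂ) :
    Matrix (Fin N → Fin d) (Fin N → Fin d) ℂ →ₗ[ℂ] Matrix (Fin d) (Fin d) ℂ where
  toFun Y := Matrix.of fun b a => ∑ k, (tensorUpdate (fun _ => ρ) k (single a b 1) * Y).trace
  map_add' Y Z := by
    ext a b
    simp only [of_apply, Matrix.add_apply, Matrix.mul_add, trace_add, Finset.sum_add_distrib]
  map_smul' c Y := by
    ext a b
    simp only [of_apply, Matrix.smul_apply, Matrix.mul_smul, trace_smul, Finset.smul_sum,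
      RingHom.id_apply]

variable {ρ : Matrix (Fin d) (Fin d) ℂ}

/-- The defining duality of `siteTrace`, extended from matrix units by linearity. By the product
rule it also computes derivatives of the N-copy state. -/
theorem trace_mul_siteTrace (B : Matrix (Fin d) (Fin d) ℂ)
    (Y : Matrix (Fin N → Fin d) (Fin N → Fin d) ℂ) :
    (B * siteTrace ρ Y).trace = ∑ k, (tensorUpdate (fun _ => ρ) k B * Y).trace := by
  have h : ∀ k : Fin N, (tensorUpdate (fun _ => ρ) k B * Y).trace
      = ∑ a, ∑ b, B a b * (tensorUpdate (fun _ => ρ) k (single a b 1) * Y).trace := by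
    intro k
    conv_lhs => rw [matrix_eq_sum_single B]
    simp only [map_sum, Matrix.sum_mul, trace_sum]
    refine Finset.sum_congr rfl fun a _ => Finset.sum_congr rfl fun b _ => ?_
    have h1 : single a b (B a b) = B a b • single a b (1 : ℂ) := by
      rw [smul_single, smul_eq_mul, mul_one]
    rw [h1, map_smul, Matrix.smul_mul, trace_smul, smul_eq_mul]
  simp only [h]
  rw [Finset.sum_comm, trace]
  refine Finset.sum_congr rfl fun a _ => ?_
  rw [Finset.sum_comm, diag_apply, mul_apply]
  refine Finset.sum_congr rfl fun b _ => ?_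
  rw [← Finset.mul_sum]
  rfl

theorem siteTrace_conjTranspose (hρ : ρ.IsHermitian)
    (Y : Matrix (Fin N → Fin d) (Fin N → Fin d) ℂ) :
    siteTrace ρ Yᴴ = (siteTrace ρ Y)ᴴ := by
  refine ext_iff_trace_mul_left.2 fun B => ?_
  have h1 : (B * (siteTrace ρ Y)ᴴ).trace = star (Bᴴ * siteTrace ρ Y).trace := by
    rw [← trace_conjTranspose, conjTranspose_mul, conjTranspose_conjTranspose, trace_mul_comm]
  rw [h1, trace_mul_siteTrace, trace_mul_siteTrace, star_sum]
  refine Finset.sum_congr rfl fun k _ => ?_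
  rw [← trace_conjTranspose, conjTranspose_mul, tensorUpdate_conjTranspose,
    conjTranspose_conjTranspose, hρ.eq, trace_mul_comm]

theorem trace_mul_siteTrace_self (Y : Matrix (Fin N → Fin d) (Fin N → Fin d) ℂ) :
    (ρ * siteTrace ρ Y).trace = N * (tensorPower N ρ * Y).trace := by
  rw [trace_mul_siteTrace]
  have : ∀ k : Fin N, tensorUpdate (fun _ => ρ) k ρ = tensorPower N ρ := fun k => by
    rw [tensorUpdate_apply, tensorPower_eq_tensorProd]
    congr 1
    exact Function.update_eq_self k _
  simp [this]

/-- The sum over the sites of the matrix `A` acting on that site. -/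
def siteSum (N : ℕ) (A : Matrix (Fin d) (Fin d) ℂ) : Matrix (Fin N → Fin d) (Fin N → Fin d) ℂ :=
  ∑ k, tensorUpdate (fun _ => 1) k A

/-- The centred image of `Y` under the map `siteTrace`. -/
def centredSiteTrace (ρ : Matrix (Fin d) (Fin d) ℂ)
    (Y : Matrix (Fin N → Fin d) (Fin N → Fin d) ℂ) : Matrix (Fin d) (Fin d) ℂ :=
  siteTrace ρ Y - (N * (tensorPower N ρ * Y).trace) • 1

theorem trace_mul_centredSiteTrace (htr : ρ.trace = 1)
    (Y : Matrix (Fin N → Fin d) (Fin N → Fin d) ℂ) :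
    (ρ * centredSiteTrace ρ Y).trace = 0 := by
  rw [centredSiteTrace, Matrix.mul_sub, trace_sub, trace_mul_siteTrace_self, Matrix.mul_smul,
    trace_smul, Matrix.mul_one, htr]
  simp

theorem tensorUpdate_one_mul (k : Fin N) (A : Matrix (Fin d) (Fin d) ℂ) :
    tensorUpdate (fun _ => 1) k A * tensorPower N ρ = tensorUpdate (fun _ => ρ) k (A * ρ) := by
  rw [tensorUpdate_apply, tensorUpdate_apply, tensorPower_eq_tensorProd, tensorProd_mul]
  congr 1
  funext l
  rcases eq_or_ne l k with rfl | h
  · simp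
  · simp [h]

/-- `siteSum` and `siteTrace` are adjoint for the inner products weighted by the states; the
centring constant drops out because trace(Aρ) = 0. -/
theorem trace_siteSum_mul_conjTranspose (hρ : ρ.IsHermitian) (htr : ρ.trace = 1)
    (Y : Matrix (Fin N → Fin d) (Fin N → Fin d) ℂ) :
    (siteSum N (centredSiteTrace ρ Y) * tensorPower N ρ * Yᴴ).trace
      = (centredSiteTrace ρ Y * ρ * (centredSiteTrace ρ Y)ᴴ).trace := by
  set A := centredSiteTrace ρ Y with hA
  have h1 : (siteSum N A * tensorPower N ρ * Yᴴ).trace = (A * ρ * (siteTrace ρ Y)ᴴ).trace := by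
    rw [← siteTrace_conjTranspose hρ, trace_mul_siteTrace, siteSum, Matrix.sum_mul, Matrix.sum_mul,
      trace_sum]
    simp only [tensorUpdate_one_mul]
  have h2 : siteTrace ρ Y = A + (N * (tensorPower N ρ * Y).trace) • 1 := by
    rw [hA, centredSiteTrace, sub_add_cancel]
  have h3 : (A * ρ).trace = 0 := by rw [trace_mul_comm, hA, trace_mul_centredSiteTrace htr]
  rw [h1, h2, conjTranspose_add, conjTranspose_smul, conjTranspose_one, Matrix.mul_add, trace_add,
    Matrix.mul_smul, trace_smul, Matrix.mul_one, h3, smul_zero, add_zero]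

/-- Additivity of variance for independent centred terms: a cross term between distinct sites
contains the factor trace(Aρ) = 0. -/
theorem trace_siteSum_mul_siteSum {A : Matrix (Fin d) (Fin d) ℂ} (htr : ρ.trace = 1)
    (hA : (A * ρ).trace = 0) :
    (siteSum N A * tensorPower N ρ * (siteSum N A)ᴴ).trace = N * (A * ρ * Aᴴ).trace := by
  have key : ∀ k l : Fin N, (tensorUpdate (fun _ => 1) k A * tensorPower N ρ *
      (tensorUpdate (fun _ => 1) l A)ᴴ).trace = if k = l then (A * ρ * Aᴴ).trace else 0 := by
    intro k l
    rw [tensorUpdate_one_mul, tensorUpdate_conjTranspose, tensorUpdate_apply, tensorUpdate_apply,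
      tensorProd_mul, trace_tensorProd]
    split_ifs with h
    · subst h
      rw [Finset.prod_eq_single k]
      · simp
      · intro i _ hi
        simp [hi, htr]
      · simp
    · refine Finset.prod_eq_zero (Finset.mem_univ k) ?_
      simp [h, hA]
  simp only [siteSum, conjTranspose_sum, Matrix.sum_mul, Matrix.mul_sum, trace_sum, key]
  simp

theorem centredSiteTrace_sum {ι : Type*} (s : Finset ι) (c : ι → ℂ)
    (Y : ι → Matrix (Fin N → Fin d) (Fin N → Fin d) ℂ) :
    centredSiteTrace ρ (∑ j ∈ s, c j • Y j) = ∑ j ∈ s, c j • centredSiteTrace ρ (Y j) := by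
  simp only [centredSiteTrace, map_sum, map_smul, trace_sum, Matrix.mul_smul,
    trace_smul, Finset.mul_sum, Finset.sum_smul, smul_sub, Finset.sum_sub_distrib, smul_smul,
    smul_eq_mul]
  congr 1
  exact Finset.sum_congr rfl fun j _ => by congr 1; ring

theorem centredSiteTrace_isHermitian (hρ : ρ.PosSemidef)
    {Y : Matrix (Fin N → Fin d) (Fin N → Fin d) ℂ} (hY : Y.IsHermitian) :
    (centredSiteTrace ρ Y).IsHermitian := by
  refine IsHermitian.sub ?_ (isHermitian_one.smul ?_)
  · rw [IsHermitian, ← siteTrace_conjTranspose hρ.isHermitian, hY.eq]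
  · rw [IsSelfAdjoint, star_mul', ← trace_conjTranspose, conjTranspose_mul, hY.eq,
      (tensorPower_posSemidef hρ).isHermitian.eq, trace_mul_comm]
    simp

variable {p : ℕ} {r : EuclideanSpace ℝ (Fin p) → Matrix (Fin d) (Fin d) ℂ}
  {θ : EuclideanSpace ℝ (Fin p)}

theorem hasFDerivAt_tensorPower_apply (hdiff : ∀ a b, DifferentiableAt ℝ (fun t => r t a b) θ)
    (a b : Fin N → Fin d) :
    HasFDerivAt (fun t => tensorPower N (r t) a b)
      (∑ k, (∏ l ∈ Finset.univ.erase k, r θ (a l) (b l)) •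
        fderiv ℝ (fun t => r t (a k) (b k)) θ) θ := by
  have := HasFDerivAt.finsetProd (u := Finset.univ) (x := θ)
    (g := fun (k : Fin N) t => r t (a k) (b k)) fun k _ => (hdiff (a k) (b k)).hasFDerivAt
  exact this

theorem differentiableAt_tensorPower (hdiff : ∀ a b, DifferentiableAt ℝ (fun t => r t a b) θ)
    (a b : Fin N → Fin d) : DifferentiableAt ℝ (fun t => tensorPower N (r t) a b) θ :=
  (hasFDerivAt_tensorPower_apply hdiff a b).differentiableAt

theorem stateDeriv_tensorPower (hdiff : ∀ a b, DifferentiableAt ℝ (fun t => r t a b) θ)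
    (i : Fin p) :
    stateDeriv (fun t => tensorPower N (r t)) θ i
      = ∑ k, tensorUpdate (fun _ => r θ) k (stateDeriv r θ i) := by
  ext a b
  rw [Matrix.sum_apply, stateDeriv, of_apply, partialDeriv,
    (hasFDerivAt_tensorPower_apply hdiff a b).fderiv]
  simp only [tensorUpdate_apply, tensorProd_update_apply, stateDeriv, partialDeriv, of_apply]
  simp [mul_comm]

theorem trace_stateDeriv_tensorPower_mul
    (hdiff : ∀ a b, DifferentiableAt ℝ (fun t => r t a b) θ) (i : Fin p)
    (Y : Matrix (Fin N → Fin d) (Fin N → Fin d) ℂ) :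
    (stateDeriv (fun t => tensorPower N (r t)) θ i * Y).trace
      = (stateDeriv r θ i * siteTrace (r θ) Y).trace := by
  rw [stateDeriv_tensorPower hdiff, trace_mul_siteTrace, Matrix.sum_mul, trace_sum]

end Tensor

/-! ### Densities of measurements and integrals against them -/

namespace POVM

variable {𝒳 : Type*} [MeasurableSpace 𝒳] {n : Type*} [Fintype n] [DecidableEq n] (M : POVM 𝒳 n)

instance : IsFiniteMeasure M.traceMeasure := by
  unfold traceMeasure
  infer_instance

theorem entry_apply (a b : n) (B : Set 𝒳) : M.entry a b B = M.toVectorMeasure B a b := rfl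

/-- A positive matrix of trace zero is zero. This is the absolute continuity behind the
Radon–Nikodym density. -/
theorem toVectorMeasure_eq_zero {B : Set 𝒳} (hB : MeasurableSet B) (h : M.traceMeasure B = 0) :
    M.toVectorMeasure B = 0 := by
  rw [traceMeasure, SignedMeasure.toMeasureOfZeroLE_apply _ _ _ hB, ENNReal.coe_eq_zero,
    ← NNReal.coe_eq_zero] at h
  have hre : (M.toVectorMeasure B).trace.re = 0 := by
    rw [← traceSigned_apply]
    simpa using h
  have hpsd := M.posSemidef B hB
  exact hpsd.trace_eq_zero_iff.1
    (Complex.ext hre (Complex.le_def.1 hpsd.trace_nonneg).2.symm)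

theorem setIntegral_matrixDensity (a b : n) {B : Set 𝒳} (hB : MeasurableSet B) :
    ∫ x in B, M.matrixDensity x a b ∂M.traceMeasure = M.toVectorMeasure B a b := by
  have hac : ∀ s : SignedMeasure 𝒳, (∀ B, MeasurableSet B → M.toVectorMeasure B = 0 → s B = 0) →
      s ≪ᵥ M.traceMeasure.toENNRealVectorMeasure := by
    intro s hs
    refine VectorMeasure.AbsolutelyContinuous.mk fun B hB h0 => ?_
    rw [Measure.toENNRealVectorMeasure_apply_measurable hB] at h0
    exact hs B hB (M.toVectorMeasure_eq_zero hB h0)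
  set c := M.entry a b with hc
  have hre := (SignedMeasure.absolutelyContinuous_iff_withDensityᵥ_rnDeriv_eq
    (ComplexMeasure.re c) M.traceMeasure).1 (hac _ fun B _ h => by
      change (M.entry a b B).re = 0
      rw [entry_apply, h]; rfl)
  have him := (SignedMeasure.absolutelyContinuous_iff_withDensityᵥ_rnDeriv_eq
    (ComplexMeasure.im c) M.traceMeasure).1 (hac _ fun B _ h => by
      change (M.entry a b B).im = 0
      rw [entry_apply, h]; rfl)
  have hint := c.integrable_rnDeriv M.traceMeasure
  change ∫ x in B, c.rnDeriv M.traceMeasure x ∂M.traceMeasure = c B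
  apply Complex.ext
  · rw [← RCLike.re_eq_complex_re, ← integral_re hint.integrableOn]
    change ∫ x in B, c.re.rnDeriv M.traceMeasure x ∂M.traceMeasure = ComplexMeasure.re c B
    conv_rhs => rw [← hre]
    rw [withDensityᵥ_apply (SignedMeasure.integrable_rnDeriv _ _) hB]
  · rw [← RCLike.im_eq_complex_im, ← integral_im hint.integrableOn]
    change ∫ x in B, c.im.rnDeriv M.traceMeasure x ∂M.traceMeasure = ComplexMeasure.im c B
    conv_rhs => rw [← him]
    rw [withDensityᵥ_apply (SignedMeasure.integrable_rnDeriv _ _) hB]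

theorem integrable_matrixDensity (a b : n) :
    Integrable (fun x => M.matrixDensity x a b) M.traceMeasure :=
  (M.entry a b).integrable_rnDeriv M.traceMeasure

theorem measurable_matrixDensity (a b : n) : Measurable fun x => M.matrixDensity x a b := by
  have h1 := SignedMeasure.measurable_rnDeriv (ComplexMeasure.re (M.entry a b)) M.traceMeasure
  have h2 := SignedMeasure.measurable_rnDeriv (ComplexMeasure.im (M.entry a b)) M.traceMeasure
  exact measurable_of_re_im h1 h2

theorem trace_mul_matrixDensity (C : Matrix n n ℂ) (x : 𝒳) :
    (C * M.matrixDensity x).trace = ∑ a, ∑ b, C a b * M.matrixDensity x b a := by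
  simp [trace, mul_apply]

theorem measurable_trace_mul_matrixDensity (C : Matrix n n ℂ) :
    Measurable fun x => (C * M.matrixDensity x).trace := by
  simp only [trace_mul_matrixDensity]
  exact Finset.measurable_sum _ fun a _ => Finset.measurable_sum _ fun b _ =>
    (M.measurable_matrixDensity b a).const_mul _

theorem mul_trace_mul_matrixDensity (c : ℂ) (C : Matrix n n ℂ) (x : 𝒳) :
    c * (C * M.matrixDensity x).trace = ∑ a, ∑ b, C a b * (c * M.matrixDensity x b a) := by
  simp only [trace_mul_matrixDensity, Finset.mul_sum]
  exact Finset.sum_congr rfl fun a _ => Finset.sum_congr rfl fun b _ => by ring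

/-- The matrix `∫ h dM`. -/
noncomputable def smear (h : 𝒳 → ℂ) : Matrix n n ℂ :=
  Matrix.of fun a b => ∫ x, h x * M.matrixDensity x a b ∂M.traceMeasure

variable {M} {h : 𝒳 → ℂ} {K : ℝ}

theorem integrable_mul_matrixDensity (hm : Measurable h) (hK : ∀ x, ‖h x‖ ≤ K) (a b : n) :
    Integrable (fun x => h x * M.matrixDensity x a b) M.traceMeasure :=
  (M.integrable_matrixDensity a b).bdd_mul hm.aestronglyMeasurable (.of_forall hK)

theorem integrable_mul_trace (hm : Measurable h) (hK : ∀ x, ‖h x‖ ≤ K) (C : Matrix n n ℂ) :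
    Integrable (fun x => h x * (C * M.matrixDensity x).trace) M.traceMeasure := by
  simp only [mul_trace_mul_matrixDensity]
  exact integrable_finsetSum _ fun a _ => integrable_finsetSum _ fun b _ =>
    (integrable_mul_matrixDensity hm hK b a).const_mul _

theorem integral_mul_trace (hm : Measurable h) (hK : ∀ x, ‖h x‖ ≤ K) (C : Matrix n n ℂ) :
    ∫ x, h x * (C * M.matrixDensity x).trace ∂M.traceMeasure = (C * M.smear h).trace := by
  have h1 : (C * M.smear h).trace
      = ∑ a, ∑ b, C a b * ∫ x, h x * M.matrixDensity x b a ∂M.traceMeasure := by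
    simp [trace, mul_apply, smear]
  simp only [h1, mul_trace_mul_matrixDensity]
  rw [integral_finsetSum]
  · refine Finset.sum_congr rfl fun a _ => ?_
    rw [integral_finsetSum]
    · exact Finset.sum_congr rfl fun b _ => integral_const_mul _ _
    · exact fun b _ => (integrable_mul_matrixDensity hm hK b a).const_mul _
  · exact fun a _ => integrable_finsetSum _ fun b _ =>
      (integrable_mul_matrixDensity hm hK b a).const_mul _

variable (M) in
theorem smear_one : M.smear (fun _ => 1) = 1 := by
  ext a b
  have := M.setIntegral_matrixDensity a b MeasurableSet.univ
  rw [M.univ_eq_one, setIntegral_univ] at this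
  simpa [smear] using this

variable (M) in
theorem integrable_trace_mul (C : Matrix n n ℂ) :
    Integrable (fun x => (C * M.matrixDensity x).trace) M.traceMeasure := by
  simpa using integrable_mul_trace (M := M) (h := fun _ => 1) measurable_const
    (fun _ => norm_one.le) C

variable (M) in
theorem integral_trace_mul (C : Matrix n n ℂ) :
    ∫ x, (C * M.matrixDensity x).trace ∂M.traceMeasure = C.trace := by
  have := integral_mul_trace (M := M) (h := fun _ => 1) measurable_const (fun _ => norm_one.le) C
  simpa [smear_one] using this

variable (M) in
theorem setIntegral_trace_mul (C : Matrix n n ℂ) {B : Set 𝒳} (hB : MeasurableSet B) :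
    ∫ x in B, (C * M.matrixDensity x).trace ∂M.traceMeasure
      = (C * M.toVectorMeasure B).trace := by
  have h1 : (C * M.toVectorMeasure B).trace = ∑ a, ∑ b, C a b * M.toVectorMeasure B b a := by
    simp [trace, mul_apply]
  simp only [h1, trace_mul_matrixDensity, ← M.setIntegral_matrixDensity _ _ hB]
  rw [integral_finsetSum]
  · refine Finset.sum_congr rfl fun a _ => ?_
    rw [integral_finsetSum]
    · exact Finset.sum_congr rfl fun b _ => integral_const_mul _ _
    · exact fun b _ => ((M.integrable_matrixDensity b a).const_mul _).integrableOn
  · exact fun a _ => integrable_finsetSum _ fun b _ =>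
      ((M.integrable_matrixDensity b a).const_mul _).integrableOn

variable (M) in
theorem ae_matrixDensity_isHermitian : ∀ᵐ x ∂M.traceMeasure, (M.matrixDensity x).IsHermitian := by
  have h1 : ∀ a b, ∀ᵐ x ∂M.traceMeasure, star (M.matrixDensity x b a) = M.matrixDensity x a b := by
    intro a b
    refine Integrable.ae_eq_of_forall_setIntegral_eq _ _ ?_ (M.integrable_matrixDensity a b) ?_
    · exact (Complex.conjCLE.toContinuousLinearMap).integrable_comp (M.integrable_matrixDensity b a)
    · intro B hB _
      rw [M.setIntegral_matrixDensity a b hB, ← (M.posSemidef B hB).isHermitian.apply a b,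
        ← M.setIntegral_matrixDensity b a hB]
      exact integral_conj
  filter_upwards [ae_all_iff.2 fun a => ae_all_iff.2 (h1 a)] with x hx
  exact IsHermitian.ext hx

variable (M) in
theorem ae_matrixDensity_posSemidef : ∀ᵐ x ∂M.traceMeasure, (M.matrixDensity x).PosSemidef := by
  have h1 : ∀ v : n → ℂ, ∀ᵐ x ∂M.traceMeasure, 0 ≤ (star v ⬝ᵥ M.matrixDensity x *ᵥ v).re := by
    intro v
    have hv : ∀ A : Matrix n n ℂ, star v ⬝ᵥ A *ᵥ v = (vecMulVec v (star v) * A).trace := fun A => by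
      rw [trace_mul_comm, trace_mul_vecMulVec_star]
    simp only [hv]
    have hint := M.integrable_trace_mul (vecMulVec v (star v))
    refine ae_nonneg_of_forall_setIntegral_nonneg hint.re fun B hB _ => ?_
    change 0 ≤ ∫ x in B, RCLike.re (vecMulVec v (star v) * M.matrixDensity x).trace ∂M.traceMeasure
    have : ∫ x in B, RCLike.re (vecMulVec v (star v) * M.matrixDensity x).trace ∂M.traceMeasure
        = ((vecMulVec v (star v) * M.toVectorMeasure B).trace).re := by
      rw [integral_re hint.integrableOn, M.setIntegral_trace_mul _ hB]
      rfl
    rw [this, ← hv]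
    exact (Complex.le_def.1 ((M.posSemidef B hB).dotProduct_mulVec_nonneg v)).1
  -- The null set depends on v, so positivity is first obtained on a countable dense set of vectors
  -- and then extended by continuity.
  have h2 : ∀ᵐ x ∂M.traceMeasure, ∀ k : ℕ,
      0 ≤ (star (TopologicalSpace.denseSeq (n → ℂ) k) ⬝ᵥ
        M.matrixDensity x *ᵥ TopologicalSpace.denseSeq (n → ℂ) k).re :=
    ae_all_iff.2 fun k => h1 _
  filter_upwards [h2, M.ae_matrixDensity_isHermitian] with x hx hH
  refine .of_dotProduct_mulVec_nonneg hH fun v => ?_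
  have hre : 0 ≤ (star v ⬝ᵥ M.matrixDensity x *ᵥ v).re := by
    have hcl : IsClosed {v : n → ℂ | 0 ≤ (star v ⬝ᵥ M.matrixDensity x *ᵥ v).re} :=
      isClosed_le continuous_const (Complex.continuous_re.comp (by fun_prop))
    have := (TopologicalSpace.denseRange_denseSeq (n → ℂ)).closure_eq ▸ Set.mem_univ v
    exact closure_minimal (by rintro _ ⟨k, rfl⟩; exact hx k) hcl this
  have him : (star v ⬝ᵥ M.matrixDensity x *ᵥ v).im = 0 := hH.im_star_dotProduct_mulVec_self v
  exact Complex.le_def.2 ⟨hre, him.symm⟩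

variable (M h) in
theorem conjTranspose_smear : (M.smear h)ᴴ = M.smear fun x => star (h x) := by
  ext a b
  simp only [smear, conjTranspose_apply, of_apply]
  have h1 : star (∫ x, h x * M.matrixDensity x b a ∂M.traceMeasure)
      = ∫ x, star (h x * M.matrixDensity x b a) ∂M.traceMeasure := integral_conj.symm
  rw [h1]
  refine integral_congr_ae ?_
  filter_upwards [M.ae_matrixDensity_isHermitian] with x hx
  rw [star_mul', hx.apply]

/-- The Cauchy–Schwarz inequality behind the quantum information bounds. -/
theorem quadratic_nonneg (hm : Measurable h) (hK : ∀ x, ‖h x‖ ≤ K) {T : Matrix n n ℂ}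
    (hT : T.PosSemidef) (S : Matrix n n ℂ) (r : ℝ) :
    0 ≤ r ^ 2 * ∫ x, ‖h x‖ ^ 2 * (T * M.matrixDensity x).trace.re ∂M.traceMeasure
      - 2 * r * (S * T * (M.smear h)ᴴ).trace.re + (S * T * Sᴴ).trace.re := by
  -- Pointwise expansion of trace(T B*mB) ≥ 0 with B = r h(x)·1 − S; integration against total mass
  -- 1 gives the claim without dilating the measurement.
  have hpt : ∀ᵐ x ∂M.traceMeasure, 0 ≤ r ^ 2 * (‖h x‖ ^ 2 * (T * M.matrixDensity x).trace.re)
      - 2 * r * (star (h x) * (S * T * M.matrixDensity x).trace).re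
      + (S * T * Sᴴ * M.matrixDensity x).trace.re := by
    filter_upwards [M.ae_matrixDensity_posSemidef] with x hx
    set m := M.matrixDensity x
    have h0 := (Complex.le_def.1 (trace_mul_nonneg_of_posSemidef hT
      (hx.conjTranspose_mul_mul_same (((r : ℂ) * h x) • 1 - S)))).1
    have h1 : (T * (m * S)).trace = (S * T * m).trace := by
      rw [← Matrix.mul_assoc, trace_mul_comm, Matrix.mul_assoc]
    have h2 : (T * (Sᴴ * m)).trace = star (S * T * m).trace := by
      rw [← trace_conjTranspose]
      simp only [conjTranspose_mul, hT.isHermitian.eq, hx.isHermitian.eq]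
      rw [← Matrix.mul_assoc, trace_mul_comm]
    have h3 : (T * (Sᴴ * m * S)).trace = (S * T * Sᴴ * m).trace := by
      rw [← Matrix.mul_assoc, trace_mul_comm]
      simp only [Matrix.mul_assoc]
    simp only [conjTranspose_sub, conjTranspose_smul, conjTranspose_one, Matrix.sub_mul,
      Matrix.mul_sub, Matrix.smul_mul, Matrix.mul_smul, Matrix.one_mul, Matrix.mul_one, trace_sub,
      trace_smul, h1, h2, h3, smul_eq_mul, star_mul', Complex.star_def, Complex.conj_ofReal] at h0
    have h4 : ‖h x‖ ^ 2 = (h x).re * (h x).re + (h x).im * (h x).im := by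
      rw [← Complex.normSq_eq_norm_sq, Complex.normSq_apply]
    rw [h4]
    simp [Complex.mul_re, Complex.mul_im] at h0 ⊢
    linarith
  have hms : Measurable fun x => star (h x) := continuous_star.measurable.comp hm
  have hKs : ∀ x, ‖star (h x)‖ ≤ K := fun x => by rw [norm_star]; exact hK x
  have hm2 : Measurable fun x => ((‖h x‖ ^ 2 : ℝ) : ℂ) :=
    Complex.measurable_ofReal.comp (hm.norm.pow_const 2)
  have hK2 : ∀ x, ‖((‖h x‖ ^ 2 : ℝ) : ℂ)‖ ≤ K ^ 2 := fun x => by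
    rw [Complex.norm_real, norm_pow, norm_norm]
    exact pow_le_pow_left₀ (norm_nonneg _) (hK x) 2
  have i1 : Integrable (fun x => ‖h x‖ ^ 2 * (T * M.matrixDensity x).trace.re) M.traceMeasure := by
    have := (integrable_mul_trace (M := M) hm2 hK2 T).re
    refine this.congr (.of_forall fun x => ?_)
    exact Complex.re_ofReal_mul _ _
  have i2 : Integrable (fun x => (star (h x) * (S * T * M.matrixDensity x).trace).re)
      M.traceMeasure := (integrable_mul_trace hms hKs (S * T)).re
  have i3 : Integrable (fun x => (S * T * Sᴴ * M.matrixDensity x).trace.re) M.traceMeasure :=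
    (M.integrable_trace_mul (S * T * Sᴴ)).re
  have e2 : ∫ x, (star (h x) * (S * T * M.matrixDensity x).trace).re ∂M.traceMeasure
      = (S * T * (M.smear h)ᴴ).trace.re := by
    rw [conjTranspose_smear, ← integral_mul_trace hms hKs]
    exact integral_re (integrable_mul_trace hms hKs (S * T))
  have e3 : ∫ x, (S * T * Sᴴ * M.matrixDensity x).trace.re ∂M.traceMeasure
      = (S * T * Sᴴ).trace.re := by
    rw [← M.integral_trace_mul]
    exact integral_re (M.integrable_trace_mul (S * T * Sᴴ))
  have hint := integral_nonneg_of_ae hpt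
  have i12 : Integrable (fun x => r ^ 2 * (‖h x‖ ^ 2 * (T * M.matrixDensity x).trace.re)
      - 2 * r * (star (h x) * (S * T * M.matrixDensity x).trace).re) M.traceMeasure :=
    (i1.const_mul _).sub (i2.const_mul _)
  rw [integral_add i12 i3, integral_sub (i1.const_mul _) (i2.const_mul _), integral_const_mul, integral_const_mul, e2,
    e3] at hint
  exact hint

end POVM

/-! ### From bounded scores to one-copy information -/

section Information

variable {p d N : ℕ} {𝒳 : Type*} [MeasurableSpace 𝒳] {σ : Matrix (Fin d) (Fin d) ℂ}
  {δ : Fin p → Matrix (Fin d) (Fin d) ℂ} {M : POVM 𝒳 (Fin N → Fin d)}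

/-- The projection of ∫ h dM onto centred one-site sums is `siteSum N A` divided by N. Hence r = N
and S = `siteSum N A` are used in `quadratic_nonneg`: the terms N²∫ − 2N trace(AσA*) + N trace(AσA*)
give the bound. -/
theorem trace_centredSiteTrace_le (hσ : σ.PosSemidef) (htr : σ.trace = 1) (hN : 0 < N)
    {h : 𝒳 → ℂ} {K : ℝ} (hm : Measurable h) (hK : ∀ x, ‖h x‖ ≤ K) :
    (centredSiteTrace σ (M.smear h) * σ * (centredSiteTrace σ (M.smear h))ᴴ).trace.re
      ≤ N * ∫ x, ‖h x‖ ^ 2 * M.outcomeDensity (tensorPower N σ) x ∂M.traceMeasure := by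
  set A := centredSiteTrace σ (M.smear h) with hA
  have h0 := POVM.quadratic_nonneg (M := M) hm hK (tensorPower_posSemidef (N := N) hσ)
    (siteSum N A) N
  have hAσ : (A * σ).trace = 0 := by rw [trace_mul_comm, hA, trace_mul_centredSiteTrace htr]
  rw [trace_siteSum_mul_siteSum htr hAσ, hA, trace_siteSum_mul_conjTranspose hσ.isHermitian htr,
    ← hA] at h0
  have h1 : ((N : ℂ) * (A * σ * Aᴴ).trace).re = N * (A * σ * Aᴴ).trace.re := by
    simp
  rw [h1] at h0
  have hN' : (0 : ℝ) < N := by exact_mod_cast hN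
  have h2 : 0 ≤ (N : ℝ) * (N * ∫ x, ‖h x‖ ^ 2 * M.outcomeDensity (tensorPower N σ) x ∂M.traceMeasure
      - (A * σ * Aᴴ).trace.re) := by
    unfold POVM.outcomeDensity
    linarith
  linarith [nonneg_of_mul_nonneg_right h2 hN']

variable {t : Fin p → 𝒳 → ℝ} {K : ℝ}

theorem smear_sum (ht : ∀ j, Measurable (t j)) (hK : ∀ j x, |t j x| ≤ K) (c : Fin p → ℂ) :
    M.smear (fun x => ∑ j, c j * (t j x : ℂ)) = ∑ j, c j • M.smear fun x => (t j x : ℂ) := by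
  ext a b
  have hint : ∀ j, Integrable (fun x => (t j x : ℂ) * M.matrixDensity x a b) M.traceMeasure :=
    fun j => POVM.integrable_mul_matrixDensity (h := fun x => (t j x : ℂ)) (K := K)
      (Complex.measurable_ofReal.comp (ht j))
      (fun x => by rw [Complex.norm_real]; exact hK j x) a b
  simp only [POVM.smear, of_apply, Matrix.sum_apply, Matrix.smul_apply, smul_eq_mul, Finset.sum_mul,
    mul_assoc]
  rw [integral_finsetSum _ fun j _ => (hint j).const_mul _]
  exact Finset.sum_congr rfl fun j _ => integral_const_mul _ _

theorem integrable_mul_outcomeDensity {g : 𝒳 → ℝ} (hg : Measurable g) {K : ℝ}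
    (hK : ∀ x, |g x| ≤ K) (τ : Matrix (Fin N → Fin d) (Fin N → Fin d) ℂ) :
    Integrable (fun x => g x * M.outcomeDensity τ x) M.traceMeasure := by
  have := (POVM.integrable_mul_trace (M := M) (h := fun x => (g x : ℂ))
    (Complex.measurable_ofReal.comp hg) (fun x => by rw [Complex.norm_real]; exact hK x) τ).re
  refine this.congr (.of_forall fun x => ?_)
  exact Complex.re_ofReal_mul _ _

/-- The information extracted through bounded scores is attainable on a single copy. -/
theorem mem_attainableInformation_of_score (hσ : σ.PosSemidef) (htr : σ.trace = 1)
    (hδ : ∀ i, (δ i).trace = 0) (hN : 0 < N)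
    {Δ : Fin p → Matrix (Fin N → Fin d) (Fin N → Fin d) ℂ} (hΔ : ∀ i, (Δ i).IsHermitian)
    (hΔδ : ∀ i Y, (Δ i * Y).trace = (δ i * siteTrace σ Y).trace)
    (ht : ∀ j, Measurable (t j)) (hK : ∀ j x, |t j x| ≤ K)
    (hscore : ∀ i j x, t j x * M.outcomeDensity (Δ i) x
      = t i x * t j x * M.outcomeDensity (tensorPower N σ) x) :
    ((N : ℝ)⁻¹ • Matrix.of fun i j => ∫ x, t i x * t j x * M.outcomeDensity (tensorPower N σ) x
      ∂M.traceMeasure) ∈ attainableInformation σ δ := by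
  have hN0 : (N : ℂ) ≠ 0 := by exact_mod_cast hN.ne'
  have hN' : (0 : ℝ) < N := by exact_mod_cast hN
  set V : Matrix (Fin p) (Fin p) ℝ := Matrix.of fun i j =>
    ∫ x, t i x * t j x * M.outcomeDensity (tensorPower N σ) x ∂M.traceMeasure with hV
  set Y : Fin p → Matrix (Fin N → Fin d) (Fin N → Fin d) ℂ :=
    fun j => M.smear fun x => (t j x : ℂ) with hY
  have htC : ∀ j, Measurable fun x => (t j x : ℂ) := fun j => Complex.measurable_ofReal.comp (ht j)
  have hKC : ∀ j x, ‖(t j x : ℂ)‖ ≤ K := fun j x => by rw [Complex.norm_real]; exact hK j x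
  have hYh : ∀ j, (Y j).IsHermitian := fun j => by
    rw [IsHermitian, hY, POVM.conjTranspose_smear]
    simp
  set U : Fin p → Matrix (Fin d) (Fin d) ℂ := fun j => centredSiteTrace σ (Y j) with hU
  have hUh : ∀ j, (U j).IsHermitian := fun j => centredSiteTrace_isHermitian hσ (hYh j)
  have hVs : V.IsSymm := by
    ext i j
    simp only [hV, transpose_apply, of_apply]
    exact integral_congr_ae (.of_forall fun x => by ring)
  have hUδ : ∀ i j, (δ i * U j).trace = (V i j : ℂ) := by
    intro i j
    change (δ i * (siteTrace σ (Y j) - (N * (tensorPower N σ * Y j).trace) • 1)).trace = _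
    rw [Matrix.mul_sub, trace_sub, Matrix.mul_smul, trace_smul,
      Matrix.mul_one, hδ, smul_zero, sub_zero, ← hΔδ, hY, ← POVM.integral_mul_trace (htC j) (hKC j),
      hV, of_apply, ← integral_complex_ofReal]
    refine integral_congr_ae ?_
    filter_upwards [M.ae_matrixDensity_isHermitian] with x hx
    rw [← hscore i j x]
    have him : (Δ i * M.matrixDensity x).trace.im = 0 := by
      rw [← Complex.conj_eq_iff_im, ← Complex.star_def, ← trace_conjTranspose, conjTranspose_mul,
        hx.eq, (hΔ i).eq, trace_mul_comm]
    have : (Δ i * M.matrixDensity x).trace = (M.outcomeDensity (Δ i) x : ℂ) :=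
      Complex.ext (by simp [POVM.outcomeDensity]) (by simp [him])
    rw [this]
    push_cast
    ring
  -- Apply the one-function inequality to the complex score Σ c_j t_j; complex c is needed because
  -- Z(U) is a complex Hermitian matrix.
  have hquad : ∀ c : Fin p → ℂ, (star c ⬝ᵥ zMatrix σ U *ᵥ c).re
      ≤ N * (star c ⬝ᵥ V.map (fun r : ℝ => (r : ℂ)) *ᵥ c).re := by
    intro c
    have hg : Measurable fun x => ∑ j, c j * (t j x : ℂ) :=
      Finset.measurable_sum _ fun j _ => (htC j).const_mul _
    have hgK : ∀ x, ‖∑ j, c j * (t j x : ℂ)‖ ≤ ∑ j, ‖c j‖ * K := fun x =>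
      (norm_sum_le _ _).trans (Finset.sum_le_sum fun j _ => by
        rw [norm_mul]
        exact mul_le_mul_of_nonneg_left (hKC j x) (norm_nonneg _))
    have h1 := trace_centredSiteTrace_le (M := M) hσ htr hN hg hgK
    rw [smear_sum ht hK, centredSiteTrace_sum, trace_mul_cycle, trace_mul_cycle,
      Matrix.mul_assoc] at h1
    rw [dotProduct_zMatrix_mulVec hUh]
    refine h1.trans (mul_le_mul_of_nonneg_left (le_of_eq ?_) hN'.le)
    have hint : ∀ i j, Integrable (fun x => (star (c i) * c j).re *
        (t i x * t j x * M.outcomeDensity (tensorPower N σ) x)) M.traceMeasure := fun i j =>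
      (integrable_mul_outcomeDensity ((ht i).mul (ht j)) (K := K * K) (fun x => by
        rw [Pi.mul_apply, abs_mul]
        exact mul_le_mul (hK i x) (hK j x) (abs_nonneg _) ((abs_nonneg _).trans (hK i x))) _).const_mul _
    have h2 : (star c ⬝ᵥ V.map (fun r : ℝ => (r : ℂ)) *ᵥ c).re
        = ∑ i, ∑ j, (star (c i) * c j).re * V i j := by
      simp only [dotProduct, mulVec, Finset.mul_sum, Complex.re_sum, Pi.star_apply, map_apply]
      refine Finset.sum_congr rfl fun i _ => Finset.sum_congr rfl fun j _ => ?_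
      rw [mul_comm (V i j : ℂ), ← mul_assoc, Complex.re_mul_ofReal]
    rw [h2]
    simp only [hV, of_apply, ← integral_const_mul]
    have hpt : ∀ x, ‖∑ j, c j * (t j x : ℂ)‖ ^ 2 * M.outcomeDensity (tensorPower N σ) x
        = ∑ i, ∑ j, (star (c i) * c j).re *
          (t i x * t j x * M.outcomeDensity (tensorPower N σ) x) := by
      intro x
      have h3 : ‖∑ j, c j * (t j x : ℂ)‖ ^ 2
          = (star (∑ j, c j * (t j x : ℂ)) * ∑ j, c j * (t j x : ℂ)).re := by
        rw [Complex.star_def, Complex.conj_mul']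
        exact_mod_cast rfl
      rw [h3, star_sum, Finset.sum_mul_sum, Complex.re_sum, Finset.sum_mul]
      refine Finset.sum_congr rfl fun i _ => ?_
      rw [Complex.re_sum, Finset.sum_mul]
      refine Finset.sum_congr rfl fun j _ => ?_
      have h4 : star (c i * (t i x : ℂ)) * (c j * (t j x : ℂ))
          = star (c i) * c j * ((t i x * t j x : ℝ) : ℂ) := by
        rw [star_mul', Complex.star_def, Complex.conj_ofReal]
        push_cast
        ring
      rw [h4, Complex.re_mul_ofReal]
      ring
    simp only [hpt]
    rw [integral_finsetSum _ fun i _ => integrable_finsetSum _ fun j _ => hint i j]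
    exact Finset.sum_congr rfl fun i _ => integral_finsetSum _ fun j _ => hint i j
  have hVh : (V.map fun r : ℝ => (r : ℂ)).IsHermitian := map_ofReal_isHermitian hVs
  have hZh : (zMatrix σ U).IsHermitian := zMatrix_isHermitian hσ.isHermitian hUh
  have hzm : zMatrix σ (fun j => (((N : ℝ)⁻¹ : ℝ) : ℂ) • U j)
      = (((N : ℝ)⁻¹ * (N : ℝ)⁻¹ : ℝ) : ℂ) • zMatrix σ U := by
    ext i j
    simp only [zMatrix, of_apply, Matrix.smul_apply, Matrix.mul_smul, Matrix.smul_mul, trace_smul,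
      smul_eq_mul]
    push_cast
    ring
  -- Scaling U by 1/N scales its derivatives by 1/N but Z by 1/N², so N·V ≥ Z(U) becomes V/N ≥
  -- Z(U/N).
  have hdiff : ((N : ℝ)⁻¹ • V).map (fun r : ℝ => (r : ℂ))
      - zMatrix σ (fun j => (((N : ℝ)⁻¹ : ℝ) : ℂ) • U j)
      = (((N : ℝ)⁻¹ * (N : ℝ)⁻¹ : ℝ) : ℂ) • ((N : ℂ) • V.map (fun r : ℝ => (r : ℂ))
        - zMatrix σ U) := by
    rw [hzm, smul_sub, smul_smul]
    congr 1
    ext i j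
    simp only [map_apply, Matrix.smul_apply, smul_eq_mul]
    push_cast
    rw [mul_assoc (N : ℂ)⁻¹, inv_mul_cancel₀ hN0, mul_one]
  have hpsd : ((N : ℂ) • V.map (fun r : ℝ => (r : ℂ)) - zMatrix σ U).PosSemidef := by
    have hh : ((N : ℂ) • V.map (fun r : ℝ => (r : ℂ)) - zMatrix σ U).IsHermitian :=
      (hVh.smul (by simp [IsSelfAdjoint])).sub hZh
    refine .of_dotProduct_mulVec_nonneg hh fun c => ?_
    have him := hh.im_star_dotProduct_mulVec_self c
    refine Complex.le_def.2 ⟨?_, him.symm⟩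
    have h1 : ((N : ℂ) * (star c ⬝ᵥ V.map (fun r : ℝ => (r : ℂ)) *ᵥ c)).re
        = N * (star c ⬝ᵥ V.map (fun r : ℝ => (r : ℂ)) *ᵥ c).re := by simp
    rw [sub_mulVec, dotProduct_sub, smul_mulVec, dotProduct_smul, smul_eq_mul, Complex.sub_re, h1,
      Complex.zero_re]
    linarith [hquad c]
  refine ⟨fun j => (((N : ℝ)⁻¹ : ℝ) : ℂ) • U j, fun j => (hUh j).smul (Complex.conj_ofReal _),
    fun i j => ?_, hVs.smul _, ?_⟩
  · rw [Matrix.mul_smul, trace_smul, hUδ]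
    simp
  · rw [hdiff]
    exact hpsd.smul (by exact_mod_cast by positivity)

end Information

/-! ### Average information of an arbitrary measurement -/

section AverageInformation

variable {p d N : ℕ} {𝒳 : Type*} [MeasurableSpace 𝒳]
  {ρ : EuclideanSpace ℝ (Fin p) → Matrix (Fin d) (Fin d) ℂ} {θ : EuclideanSpace ℝ (Fin p)}

theorem abs_mul_div_le {u v a b f : ℝ} (hf : 0 ≤ f) (ha : 0 ≤ a) (hb : 0 ≤ b)
    (hu : u ^ 2 ≤ a * f) (hv : v ^ 2 ≤ b * f) : |u * v / f| ≤ a + b := by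
  rcases hf.eq_or_lt with rfl | hf
  · simpa using add_nonneg ha hb
  · rw [abs_div, abs_of_pos hf, div_le_iff₀ hf, abs_mul]
    nlinarith [sq_nonneg (|u| - |v|), sq_abs u, sq_abs v, mul_nonneg ha hf.le, mul_nonneg hb hf.le]

/-- Scores may be unbounded, so they are truncated. Each truncated matrix is attainable, and the
logarithmic derivative of the N-copy state supplies an integrable majorant for the limit. -/
theorem averageInformation_mem_closure
    (hdiff : ∀ a b, DifferentiableAt ℝ (fun t => ρ t a b) θ)
    (hpos : ∀ᶠ t in 𝓝 θ, (ρ t).PosSemidef) (htr : ∀ᶠ t in 𝓝 θ, (ρ t).trace = 1)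
    (hN : 0 < N) (M : POVM 𝒳 (Fin N → Fin d)) :
    averageInformation ρ M θ ∈ closure (attainableInformation (ρ θ) (stateDeriv ρ θ)) := by
  have hσ : (ρ θ).PosSemidef := hpos.self_of_nhds
  have hposN : ∀ᶠ t in 𝓝 θ, (tensorPower N (ρ t)).PosSemidef :=
    hpos.mono fun t ht => tensorPower_posSemidef ht
  have hdiffN : ∀ a b, DifferentiableAt ℝ (fun t => tensorPower N (ρ t) a b) θ :=
    differentiableAt_tensorPower hdiff
  set Δ : Fin p → Matrix (Fin N → Fin d) (Fin N → Fin d) ℂ :=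
    stateDeriv (fun t => tensorPower N (ρ t)) θ with hΔdef
  have hΔ : ∀ i, (Δ i).IsHermitian :=
    stateDeriv_isHermitian (hposN.mono fun t ht => ht.isHermitian)
  set f : 𝒳 → ℝ := M.outcomeDensity (tensorPower N (ρ θ)) with hf
  set D : Fin p → 𝒳 → ℝ := fun i => M.outcomeDensity (Δ i) with hD
  have hfm : Measurable f := Complex.measurable_re.comp (M.measurable_trace_mul_matrixDensity _)
  have hDm : ∀ i, Measurable (D i) := fun i =>
    Complex.measurable_re.comp (M.measurable_trace_mul_matrixDensity _)
  have havg : averageInformation ρ M θ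
      = (N : ℝ)⁻¹ • Matrix.of fun i j => ∫ x, D i x * D j x / f x ∂M.traceMeasure := by
    rw [averageInformation, fisherInformation]
    congr 2
    funext i j
    refine integral_congr_ae (.of_forall fun x => ?_)
    have hx : ∀ i, partialDeriv (fun t => M.outcomeDensity (tensorPower N (ρ t)) x) θ i = D i x :=
      fun i => partialDeriv_trace_mul_re hdiffN _ i
    simp only [hx, hf]
  choose T hT hTle using fun i => exists_posSemidef_trace_sq_le (hposN.self_of_nhds) (hΔ i)
    (stateDeriv_quadratic_eq_zero hdiffN hposN i)
  -- One truncation set for all i: the score identity t_j D_i = t_i t_j f needs both scores to be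
  -- cut off at the same points.
  set E : ℕ → Set 𝒳 := fun k => {x | ∀ i, |D i x / f x| ≤ k} with hE
  have hEm : ∀ k, MeasurableSet (E k) := fun k => by
    simp only [hE, Set.ofPred_forall]
    exact MeasurableSet.iInter fun i =>
      measurableSet_le (((hDm i).div hfm).abs) measurable_const
  set t : ℕ → Fin p → 𝒳 → ℝ := fun k i => (E k).indicator fun x => D i x / f x with ht
  have htm : ∀ k i, Measurable (t k i) := fun k i => ((hDm i).div hfm).indicator (hEm k)
  have htK : ∀ k i x, |t k i x| ≤ k := fun k i x => by
    by_cases hx : x ∈ E k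
    · simpa [ht, hx] using hx i
    · simp [ht, hx]
  have hscore : ∀ k i j x, t k j x * M.outcomeDensity (Δ i) x
      = t k i x * t k j x * M.outcomeDensity (tensorPower N (ρ θ)) x := by
    intro k i j x
    change t k j x * D i x = t k i x * t k j x * f x
    by_cases hx : x ∈ E k
    · simp only [ht, Set.indicator_of_mem hx]
      -- Where f vanishes, the quotients are 0 by convention, matching the convention in the Fisher
      -- information.
      by_cases h0 : f x = 0
      · simp [h0]
      · field_simp
    · simp [ht, hx]
  have hmem := fun k => mem_attainableInformation_of_score (M := M) hσ htr.self_of_nhds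
    (trace_stateDeriv hdiff htr) hN hΔ (trace_stateDeriv_tensorPower_mul hdiff) (htm k) (htK k)
    (hscore k)
  refine mem_closure_of_tendsto ?_ (Filter.Eventually.of_forall (f := Filter.atTop) hmem)
  rw [havg]
  refine Filter.Tendsto.const_smul ?_ _
  refine tendsto_pi_nhds.2 fun i => tendsto_pi_nhds.2 fun j => ?_
  simp only [of_apply]
  refine tendsto_integral_of_dominated_convergence
    (fun x => (T i * M.matrixDensity x).trace.re + (T j * M.matrixDensity x).trace.re)
    (fun k => (((htm k i).mul (htm k j)).mul hfm).aestronglyMeasurable)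
    ((M.integrable_trace_mul (T i)).re.add (M.integrable_trace_mul (T j)).re) (fun k => ?_) ?_
  · filter_upwards [M.ae_matrixDensity_posSemidef] with x hx
    have hTx : ∀ i, 0 ≤ (T i * M.matrixDensity x).trace.re := fun i =>
      (Complex.le_def.1 (trace_mul_nonneg_of_posSemidef (hT i) hx)).1
    have hfx : 0 ≤ f x :=
      (Complex.le_def.1 (trace_mul_nonneg_of_posSemidef hposN.self_of_nhds hx)).1
    change |t k i x * t k j x * f x| ≤ _
    by_cases hxE : x ∈ E k
    · have h1 : t k i x * t k j x * f x = D i x * D j x / f x := by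
        simp only [ht, Set.indicator_of_mem hxE]
        by_cases h0 : f x = 0
        · simp [h0]
        · field_simp
      rw [h1]
      exact abs_mul_div_le hfx (hTx i) (hTx j) (hTle i _ hx) (hTle j _ hx)
    · have h1 : t k i x = 0 := by simp [ht, hxE]
      rw [h1, zero_mul, zero_mul, abs_zero]
      exact add_nonneg (hTx i) (hTx j)
  · refine .of_forall fun x => ?_
    obtain ⟨k₀, hk₀⟩ := exists_nat_ge (∑ i, |D i x / f x|)
    refine tendsto_const_nhds.congr' ?_
    filter_upwards [Filter.eventually_ge_atTop k₀] with k hk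
    have hxE : x ∈ E k := fun i =>
      (Finset.single_le_sum (f := fun i => |D i x / f x|) (fun i _ => abs_nonneg _)
        (Finset.mem_univ i)).trans (hk₀.trans (by exact_mod_cast hk))
    change D i x * D j x / f x = t k i x * t k j x * f x
    simp only [ht, Set.indicator_of_mem hxE]
    by_cases h0 : f x = 0
    · simp [h0]
    · field_simp

theorem holevoBound_eq_supportLevel (hdiff : ∀ a b, DifferentiableAt ℝ (fun t => ρ t a b) θ) :
    holevoBound ρ θ = supportLevel (attainableVariance (ρ θ) (stateDeriv ρ θ)) := by
  funext G
  rw [holevoBound, supportLevel]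
  congr 1
  ext c
  simp only [IsLocallyUnbiased, partialDeriv_trace_mul hdiff, attainableVariance, Set.mem_image,
    Set.mem_ofPred_eq]
  constructor
  · rintro ⟨X, V, ⟨hX, hδ⟩, hV, hZ, rfl⟩
    exact ⟨V, ⟨X, hX, hδ, hV, hZ⟩, rfl⟩
  · rintro ⟨V, ⟨X, hX, hδ, hV, hZ⟩, rfl⟩
    exact ⟨X, V, ⟨hX, hδ⟩, hV, hZ, rfl⟩

theorem isVarianceRegion_of_isLocallyUnbiased
    (hdiff : ∀ a b, DifferentiableAt ℝ (fun t => ρ t a b) θ)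
    (hpos : ∀ᶠ t in 𝓝 θ, (ρ t).PosSemidef) (hfin : ∃ X, IsLocallyUnbiased ρ θ X) :
    IsVarianceRegion (attainableVariance (ρ θ) (stateDeriv ρ θ)) := by
  have hσ : (ρ θ).PosSemidef := hpos.self_of_nhds
  choose β hβ hβle using fun i => exists_trace_sq_le hσ
    (stateDeriv_isHermitian (hpos.mono fun t ht => ht.isHermitian) i)
    (stateDeriv_quadratic_eq_zero hdiff hpos i)
  refine isVarianceRegion_attainableVariance (β := ∑ i, β i)
    (Finset.sum_nonneg fun i _ => hβ i) hσ (fun i X hX => ?_) ?_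
  · refine (hβle i X hX).trans (mul_le_mul_of_nonneg_right
      (Finset.single_le_sum (fun i _ => hβ i) (Finset.mem_univ i)) ?_)
    have := posSemidef_conjTranspose_mul_self X
    rw [hX.eq] at this
    exact (Complex.le_def.1 (trace_mul_nonneg_of_posSemidef hσ this)).1
  · obtain ⟨X, hX, hXδ⟩ := hfin
    refine ⟨X, hX, fun i j => ?_⟩
    rw [← partialDeriv_trace_mul hdiff, hXδ]

end AverageInformation

end QuantumStat

/-! ### Assembly of the theorem -/

theorem theorem2 {p d : ℕ} (Θ : Set (EuclideanSpace ℝ (Fin p)))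
    (ρ : EuclideanSpace ℝ (Fin p) → Matrix (Fin d) (Fin d) ℂ)
    (hρ : ∀ t ∈ Θ, QuantumStat.IsDensityMatrix (ρ t))
    (θ : EuclideanSpace ℝ (Fin p)) (hθ : θ ∈ interior Θ)
    (hdiff : ∀ a b, DifferentiableAt ℝ (fun t => ρ t a b) θ)
    (hfin : ∃ X, QuantumStat.IsLocallyUnbiased ρ θ X) :
    -- the Holevo bounds on inverse average information
    (∀ (𝒳 : Type*) [MeasurableSpace 𝒳] (N : ℕ), 0 < N →
      ∀ M : QuantumStat.POVM 𝒳 (Fin N → Fin d),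
        IsUnit (QuantumStat.averageInformation ρ M θ) →
        ∀ G : Matrix (Fin p) (Fin p) ℝ, G.PosDef →
          QuantumStat.holevoBound ρ θ G
            ≤ (G * (QuantumStat.averageInformation ρ M θ)⁻¹).trace) ∧
    -- the dual bounds on average information
    (∀ (𝒳 : Type*) [MeasurableSpace 𝒳] (N : ℕ), 0 < N →
      ∀ M : QuantumStat.POVM 𝒳 (Fin N → Fin d),
        ∀ K : Matrix (Fin p) (Fin p) ℝ, K.PosDef →
          (K * QuantumStat.averageInformation ρ M θ).trace
            ≤ QuantumStat.dualHolevoBound ρ θ K) ∧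
    -- correspondence of the two families
    (∀ I₀ ∈ QuantumStat.informationSet ρ θ, ∀ G₀ : Matrix (Fin p) (Fin p) ℝ, G₀.PosDef →
      (G₀ * I₀⁻¹).trace = QuantumStat.holevoBound ρ θ G₀ →
        QuantumStat.dualHolevoBound ρ θ (I₀⁻¹ * G₀ * I₀⁻¹)
          = QuantumStat.holevoBound ρ θ G₀) ∧
    (∀ I₀ ∈ QuantumStat.informationSet ρ θ, ∀ K₀ : Matrix (Fin p) (Fin p) ℝ, K₀.PosDef →
      (K₀ * I₀).trace = QuantumStat.dualHolevoBound ρ θ K₀ →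
        QuantumStat.holevoBound ρ θ (I₀ * K₀ * I₀)
          = QuantumStat.dualHolevoBound ρ θ K₀) ∧
    -- none of the bounds is redundant
    (∀ G : Matrix (Fin p) (Fin p) ℝ, G.PosDef →
      IsGLB ((fun V : Matrix (Fin p) (Fin p) ℝ => (G * V).trace) ''
        QuantumStat.varianceSet ρ θ) (QuantumStat.holevoBound ρ θ G)) ∧
    (∀ K : Matrix (Fin p) (Fin p) ℝ, K.PosDef →
      IsLUB ((fun I : Matrix (Fin p) (Fin p) ℝ => (K * I).trace) ''
        QuantumStat.informationSet ρ θ) (QuantumStat.dualHolevoBound ρ θ K)) ∧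
    -- the minimizer exists and is unique
    (∀ G : Matrix (Fin p) (Fin p) ℝ, G.PosDef →
      ∃! V : Matrix (Fin p) (Fin p) ℝ, V ∈ QuantumStat.varianceSet ρ θ ∧
        (G * V).trace = QuantumStat.holevoBound ρ θ G) := by
  have hΘ : Θ ∈ 𝓝 θ := mem_interior_iff_mem_nhds.1 hθ
  have hpos : ∀ᶠ t in 𝓝 θ, (ρ t).PosSemidef := Filter.mem_of_superset hΘ fun t ht => (hρ t ht).1
  have htr : ∀ᶠ t in 𝓝 θ, (ρ t).trace = 1 := Filter.mem_of_superset hΘ fun t ht => (hρ t ht).2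
  have h := QuantumStat.isVarianceRegion_of_isLocallyUnbiased hdiff hpos hfin
  have hC := QuantumStat.holevoBound_eq_supportLevel hdiff
  set R := QuantumStat.attainableVariance (ρ θ) (QuantumStat.stateDeriv ρ θ)
  have hV : QuantumStat.varianceSet ρ θ = QuantumStat.supportedSet R := by
    simp only [QuantumStat.varianceSet, QuantumStat.supportedSet, hC]
  have hI : QuantumStat.informationSet ρ θ = QuantumStat.supportedInvSet R := by
    simp only [QuantumStat.informationSet, QuantumStat.supportedInvSet, hC]
  simp only [QuantumStat.dualHolevoBound, hV, hI, hC]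
  refine ⟨fun 𝒳 _ N hN M hu G hG => ?_, fun 𝒳 _ N hN M K hK => ?_, fun I₀ hI₀ G₀ hG₀ heq =>
    h.sSup_eq_supportLevel hI₀ hG₀ heq, fun I₀ hI₀ K₀ hK₀ heq => h.supportLevel_eq_sSup hI₀ hK₀ heq,
    h.isGLB_supportLevel, fun K hK => h.isLUB_sSup hK, fun G hG => h.existsUnique_trace_mul_eq hG⟩
  · have hcl := closure_minimal
      (QuantumStat.attainableInformation_subset_closure hpos.self_of_nhds h) isClosed_closure
      (QuantumStat.averageInformation_mem_closure hdiff hpos htr hN M)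
    -- A limit of positive definite matrices is semidefinite, and invertibility makes it definite.
    exact (h.mem_supportedInvSet_of_mem_closure hcl
      ((QuantumStat.IsVarianceRegion.posSemidef_of_mem_closure hcl).posDef_iff_isUnit.2 hu)).2 G hG
  · exact h.trace_mul_le_sSup_of_mem_closure hK (closure_minimal
      (QuantumStat.attainableInformation_subset_closure hpos.self_of_nhds h) isClosed_closure
      (QuantumStat.averageInformation_mem_closure hdiff hpos htr hN M))
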